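/- A Grand Schröder path of semi-length $n$ is a lattice path from $(0,0)$ to $(2n,0)$ consisting of steps $U=(1,1)$, $D=(1,-1)$ and $H=(2,0)$. Let $GS_n$ be the set of these paths, ordered by declaring $\gamma_1\le\gamma_2$ when $\gamma_1$ lies weakly below $\gamma_2$ (the $n$-th Grand Schröder lattice). For a finite poset $P$ let $\ell(P)$ be the number of edges of its Hasse diagram, i.e. the number of pairs $(x,y)\in P\times P$ such that $y$ covers $x$, and let $i(P)=\ell(P)/|P|$ be its Hasse index. Theorem. The edge generating series $\ell_{GS}(x)=\sum_{n\ge0}\ell(GS_n)\,x^n$ of the Grand Schröder lattices is the formal power series $$\ell_{GS}(x)=\frac{2(x-x^2)}{(1-6x+x^2)^{3/2}}.$$ Moreover, for every $n\ge0$, $$\ell(GS_n)=2\sum_{k=0}^{n}\binom{n+k}{2k}\binom{2k}{k}(n-k)$$ and $$\ell(GS_n)=\sum_{k=0}^{\lfloor n/2\rfloor}\binom{n}{k}\binom{n-k}{k}\frac{(n-2k)(n+k+2)}{k+1}\,2^{k+1}\,3^{\,n-2k-2},$$ and, as $n\to+\infty$, $$\ell(GS_n)\sim\sqrt{\frac{n}{2\sqrt2\,\pi}}\;(1+\sqrt2)^{2n}\qquad\text{and}\qquad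 i(GS_n)=\frac{\ell(GS_n)}{|GS_n|}\sim(2-\sqrt2)\,n.$$ In particular, the Hasse index of the Grand Schröder lattices is asymptotically quasi Boolean: there is a constant $c$ with $0\le c\le 1/10$ such that $i(GS_n)\sim(\tfrac12+c)\,n$ or $i(GS_n)\sim(\tfrac12-c)\,n$ as $n\to+\infty$. -/

import Mathlib

open Asymptotics Filter PowerSeries

/-- The steps of a Grand Schröder path: up `U = (1,1)`, down `D = (1,-1)`,
double horizontal `H = (2,0)`. -/
inductive SchroderStep
  | U
  | D
  | H
  deriving DecidableEq

namespace SchroderStep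

/-- The vertical increments of a step over the successive unit intervals of the `x`-axis
that it spans. -/
def increments : SchroderStep → List ℤ
  | U => [1]
  | D => [-1]
  | H => [0, 0]

end SchroderStep

/-- The vertical increments of a word of steps, unit interval by unit interval. -/
def pathIncrements (w : List SchroderStep) : List ℤ :=
  w.flatMap SchroderStep.increments

/-- The ordinate, at the integer abscissa `i`, of the path with word `w` that starts at the
origin (constant after the end of the path). -/
def pathHeight (w : List SchroderStep) (i : ℕ) : ℤ :=
  ((pathIncrements w).take i).sum

/-- The Grand Schröder paths of semi-length `n`: words in `U, D, H` whose path leads from `(0,0)`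
to `(2n,0)`. -/
def GrandSchroder (n : ℕ) : Type :=
  {w : List SchroderStep // (pathIncrements w).length = 2 * n ∧ (pathIncrements w).sum = 0}

theorem pathIncrements_injective : Function.Injective pathIncrements := by
  intro v
  induction v with
  | nil =>
    intro w h
    cases w with
    | nil => rfl
    | cons b w => cases b <;> simp [pathIncrements, SchroderStep.increments] at h
  | cons a v ih =>
    intro w h
    cases w with
    | nil => cases a <;> simp [pathIncrements, SchroderStep.increments] at h
    | cons b w =>
      cases a <;> cases b <;> simp [pathIncrements, SchroderStep.increments] at h <;>
        exact congrArg _ (ih (by simpa [pathIncrements] using h))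

theorem GrandSchroder.eq_of_height_eq {n : ℕ} (a b : GrandSchroder n)
    (h : ∀ i, pathHeight a.1 i = pathHeight b.1 i) : a = b := by
  apply Subtype.ext
  apply pathIncrements_injective
  apply List.ext_getElem (a.2.1.trans b.2.1.symm)
  intro i h₁ h₂
  have e₀ := h i
  have e₁ := h (i + 1)
  simp only [pathHeight] at e₀ e₁
  rw [List.sum_take_succ _ _ h₁, List.sum_take_succ _ _ h₂] at e₁
  linarith

/-- `a ≤ b` when `a` lies weakly below `b`. Both paths are affine between consecutive integer
abscissas, so it is enough to compare them there. -/
instance (n : ℕ) : PartialOrder (GrandSchroder n) where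
  le a b := ∀ i : ℕ, pathHeight a.1 i ≤ pathHeight b.1 i
  le_refl _ _ := le_rfl
  le_trans _ _ _ h₁ h₂ i := (h₁ i).trans (h₂ i)
  le_antisymm a b h₁ h₂ := GrandSchroder.eq_of_height_eq a b fun i => le_antisymm (h₁ i) (h₂ i)

theorem length_le_length_pathIncrements (w : List SchroderStep) :
    w.length ≤ (pathIncrements w).length := by
  induction w with
  | nil => simp
  | cons a w ih => cases a <;> simp [pathIncrements, SchroderStep.increments] at ih ⊢ <;> omega

instance : Finite SchroderStep :=
  Finite.of_surjective
    (fun i : Fin 3 => ([SchroderStep.U, SchroderStep.D, SchroderStep.H] : List _).get i)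
    (fun s => by
      cases s
      exacts [⟨0, rfl⟩, ⟨1, rfl⟩, ⟨2, rfl⟩])

instance (n : ℕ) : Finite (GrandSchroder n) :=
  Set.Finite.to_subtype <| (List.finite_length_le SchroderStep (2 * n)).subset fun w hw =>
    (length_le_length_pathIncrements w).trans_eq hw.1

/-- The number `ℓ(P)` of edges of the Hasse diagram of a finite poset `P`, i.e. the number of
pairs `(x, y)` such that `y` covers `x`. -/
noncomputable def hasseEdgeCount (P : Type*) [PartialOrder P] : ℕ :=
  Nat.card {p : P × P // p.1 ⋖ p.2}

/-- The Hasse index `i(P) = ℓ(P) / |P|` of a finite poset `P`. -/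
noncomputable def hasseIndex (P : Type*) [PartialOrder P] : ℝ :=
  (hasseEdgeCount P : ℝ) / (Nat.card P : ℝ)

/-- The edge generating series of a sequence of finite posets: the ordinary generating series of
the numbers `ℓ(P n)`. -/
noncomputable def edgeSeries (P : ℕ → Type*) [∀ n, PartialOrder (P n)] : ℚ⟦X⟧ :=
  PowerSeries.mk fun n => (hasseEdgeCount (P n) : ℚ)

/-- The Hasse index of a sequence of posets is asymptotically quasi Boolean when it is equivalent
to `(1/2 + c) n` or to `(1/2 - c) n` for some constant `0 ≤ c ≤ 1/10`. -/
def IsAsymptoticallyQuasiBoolean (P : ℕ → Type*) [∀ n, PartialOrder (P n)] : Prop :=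
  ∃ c : ℝ, 0 ≤ c ∧ c ≤ 1 / 10 ∧
    ((fun n : ℕ => hasseIndex (P n)) ~[atTop] (fun n : ℕ => (1 / 2 + c) * (n : ℝ)) ∨
      (fun n : ℕ => hasseIndex (P n)) ~[atTop] (fun n : ℕ => (1 / 2 - c) * (n : ℝ)))

/-- The power `f ^ a` with rational exponent `a` of a formal power series `f` with constant
coefficient `1`, by the binomial series: `f ^ a = ∑ k, (a choose k) (f - 1) ^ k`. -/
noncomputable def PowerSeries.ratPow (f : ℚ⟦X⟧) (a : ℚ) : ℚ⟦X⟧ :=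
  (PowerSeries.binomialSeries ℚ a).subst (f - 1)

/-! ### Heights of Grand Schröder paths -/

/-! Covers are local: `b` covers `a` exactly when `b` arises from `a` by `DU → H` or `H → UD`
(`GrandSchroder.covBy_iff`). Such a move raises one ordinate by one, so nothing lies strictly
between. Conversely, below any `b > a` a move of `a` is found near a lowest point of `a` among those
where `a` is strictly below `b` (`GrandSchroder.exists_move_le`). Both kinds of move are encoded by
a path with a marked `H`, so `ℓ(GS_n)` is twice the total number of horizontal steps, and
multinomial counting gives the first sum.

Put `T = 1 - 6X + X²`. Since `T = (1-X)² - 4X = (1-3X)² - 8X²`, the series `T^(-1/2)` and `T^(-3/2)`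
can be expanded in powers of `X/(1-X)²` or of `2X²/(1-3X)²`. The first expansion recognises the
combinatorial sums, the second yields the other closed formula. Fractional powers are compared
through their squares (`eq_of_sq_eq_sq_of_constantCoeff`).

For the asymptotics, `2 ℓ(GS_n) = (7n+3)|GS_n| - (n+1)|GS_{n+1}|` reduces everything to `|GS_n|`,
which is `(1/π) ∫₀^π (3 + 2√2 cos x)^n dx` and is estimated by Laplace's method. The ratio of
consecutive cardinals tends to `3 + 2√2`, so `i(GS_n)/n → (7 - 3 - 2√2)/2 = 2 - √2`. -/

theorem pathIncrements_append (u v : List SchroderStep) :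
    pathIncrements (u ++ v) = pathIncrements u ++ pathIncrements v := by
  simp [pathIncrements]

theorem pathIncrements_cons (s : SchroderStep) (v : List SchroderStep) :
    pathIncrements (s :: v) = s.increments ++ pathIncrements v := by
  simp [pathIncrements]

theorem pathIncrements_singleton (s : SchroderStep) : pathIncrements [s] = s.increments := by
  simp [pathIncrements]

theorem pathHeight_append_length (u v : List SchroderStep) :
    pathHeight (u ++ v) (pathIncrements u).length = (pathIncrements u).sum := by
  simp [pathHeight, pathIncrements_append]

theorem pathHeight_zero (w : List SchroderStep) : pathHeight w 0 = 0 := by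
  simp [pathHeight]

theorem pathHeight_of_length_le {w : List SchroderStep} {i : ℕ}
    (h : (pathIncrements w).length ≤ i) : pathHeight w i = (pathIncrements w).sum := by
  rw [pathHeight, List.take_of_length_le h]

theorem GrandSchroder.pathHeight_of_le {n : ℕ} (a : GrandSchroder n) {i : ℕ} (h : 2 * n ≤ i) :
    pathHeight a.1 i = 0 := by
  rw [pathHeight_of_length_le (a.2.1.trans_le h), a.2.2]

/-- Each step changes the sum of the coordinates by an even number. Parity thus tells the ends of
steps from the centres of horizontal steps. -/
theorem even_sum_add_length_pathIncrements (w : List SchroderStep) :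
    Even ((pathIncrements w).sum + ((pathIncrements w).length : ℤ)) := by
  induction w with
  | nil => simp [pathIncrements]
  | cons s w ih =>
    rw [pathIncrements_cons, List.sum_append, List.length_append]
    rcases ih with ⟨c, hc⟩
    cases s
    · exact ⟨c + 1, by simp [SchroderStep.increments]; omega⟩
    · exact ⟨c, by simp [SchroderStep.increments]; omega⟩
    · exact ⟨c + 1, by simp [SchroderStep.increments]; omega⟩

theorem abs_le_one_of_mem_pathIncrements {w : List SchroderStep} {x : ℤ}
    (hx : x ∈ pathIncrements w) : |x| ≤ 1 := by
  rw [pathIncrements, List.mem_flatMap] at hx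
  obtain ⟨s, -, hs⟩ := hx
  cases s <;> simp [SchroderStep.increments] at hs <;> simp [hs]

theorem abs_pathHeight_succ_sub_le (w : List SchroderStep) (i : ℕ) :
    |pathHeight w (i + 1) - pathHeight w i| ≤ 1 := by
  by_cases hi : i < (pathIncrements w).length
  · rw [pathHeight, pathHeight, List.sum_take_succ _ _ hi, add_sub_cancel_left]
    exact abs_le_one_of_mem_pathIncrements (List.getElem_mem hi)
  · rw [pathHeight_of_length_le (by omega), pathHeight_of_length_le (by omega)]
    simp

/-- Every abscissa of a path is either an end of a step or the centre of a horizontal step. -/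
theorem exists_append_or_exists_append_H (w : List SchroderStep) (i : ℕ)
    (hi : i ≤ (pathIncrements w).length) :
    (∃ u v, w = u ++ v ∧ (pathIncrements u).length = i) ∨
      ∃ u v, w = u ++ SchroderStep.H :: v ∧ (pathIncrements u).length + 1 = i := by
  induction w generalizing i with
  | nil => exact Or.inl ⟨[], [], rfl, by simpa [pathIncrements, eq_comm] using hi⟩
  | cons s w ih =>
    rw [pathIncrements_cons, List.length_append] at hi
    by_cases h0 : i = 0
    · exact Or.inl ⟨[], s :: w, rfl, by simp [pathIncrements, h0]⟩
    by_cases hs : i < s.increments.length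
    · cases s
      · simp [SchroderStep.increments] at hs; omega
      · simp [SchroderStep.increments] at hs; omega
      · refine Or.inr ⟨[], w, rfl, ?_⟩
        simp [SchroderStep.increments, pathIncrements] at hs ⊢; omega
    · rcases ih (i - s.increments.length) (by omega) with ⟨u, v, rfl, h⟩ | ⟨u, v, rfl, h⟩
      · exact Or.inl ⟨s :: u, v, rfl, by rw [pathIncrements_cons, List.length_append]; omega⟩
      · exact Or.inr ⟨s :: u, v, rfl, by rw [pathIncrements_cons, List.length_append]; omega⟩

theorem pathHeight_append_H (u v : List SchroderStep) :
    pathHeight (u ++ SchroderStep.H :: v) ((pathIncrements u).length + 1) =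
      (pathIncrements u).sum := by
  rw [pathHeight, pathIncrements_append, List.take_length_add_append]
  simp [pathIncrements_cons, SchroderStep.increments]

theorem pathHeight_append_cons (u v : List SchroderStep) (s : SchroderStep) :
    pathHeight (u ++ s :: v) ((pathIncrements u).length + s.increments.length) =
      (pathIncrements u).sum + s.increments.sum := by
  rw [List.append_cons]
  have := pathHeight_append_length (u ++ [s]) v
  simpa [pathIncrements_append, pathIncrements] using this

/-- A path is constant around an abscissa which is the centre of a horizontal step. -/
theorem pathHeight_eq_of_odd {w : List SchroderStep} {i : ℕ} (hi : i ≤ (pathIncrements w).length)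
    (h : Odd (pathHeight w i + i)) :
    pathHeight w (i + 1) = pathHeight w i ∧ pathHeight w (i - 1) = pathHeight w i := by
  rcases exists_append_or_exists_append_H w i hi with ⟨u, v, rfl, rfl⟩ | ⟨u, v, rfl, rfl⟩
  · rw [pathHeight_append_length] at h
    exact absurd (even_sum_add_length_pathIncrements u) (Int.not_even_iff_odd.2 h)
  · rw [pathHeight_append_H, add_tsub_cancel_right, pathHeight_append_length]
    refine ⟨?_, rfl⟩
    simpa [SchroderStep.increments] using pathHeight_append_cons u v SchroderStep.H

/-- Shifting one unit from an increment to the preceding one affects only the partial sum that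
separates them. Both elementary moves have this form, with `(x, y) = (0, 0)` and `(-1, 1)`. -/
theorem List.sum_take_append_shift (p q : List ℤ) (x y : ℤ) (j : ℕ) :
    ((p ++ (x + 1) :: (y - 1) :: q).take j).sum =
      ((p ++ x :: y :: q).take j).sum + if j = p.length + 1 then 1 else 0 := by
  induction p generalizing j with
  | nil =>
    rcases j with _ | _ | j
    · simp
    · simp
    · simp
      ring
  | cons z p ih =>
    rcases j with _ | j
    · simp
    · simp [ih, add_assoc]

theorem pathHeight_append_U_D (u v : List SchroderStep) (j : ℕ) :
    pathHeight (u ++ SchroderStep.U :: SchroderStep.D :: v) j =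
      pathHeight (u ++ SchroderStep.H :: v) j +
        if j = (pathIncrements u).length + 1 then 1 else 0 := by
  simpa [pathHeight, pathIncrements_append, pathIncrements_cons, SchroderStep.increments] using
    List.sum_take_append_shift (pathIncrements u) (pathIncrements v) 0 0 j

theorem pathHeight_append_H_eq_append_D_U (u v : List SchroderStep) (j : ℕ) :
    pathHeight (u ++ SchroderStep.H :: v) j =
      pathHeight (u ++ SchroderStep.D :: SchroderStep.U :: v) j +
        if j = (pathIncrements u).length + 1 then 1 else 0 := by
  simpa [pathHeight, pathIncrements_append, pathIncrements_cons, SchroderStep.increments] using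
    List.sum_take_append_shift (pathIncrements u) (pathIncrements v) (-1) 1 j

/-! ### The covering relation -/

/-- The elementary moves on words of steps: a valley `DU` is filled to a horizontal step `H`, or a
horizontal step `H` is raised to a peak `UD`. -/
inductive SchroderMove : List SchroderStep → List SchroderStep → Prop
  | fill (u v : List SchroderStep) :
      SchroderMove (u ++ SchroderStep.D :: SchroderStep.U :: v) (u ++ SchroderStep.H :: v)
  | raise (u v : List SchroderStep) :
      SchroderMove (u ++ SchroderStep.H :: v) (u ++ SchroderStep.U :: SchroderStep.D :: v)

theorem SchroderMove.exists_pathHeight_eq {a b : List SchroderStep} (h : SchroderMove a b) :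
    ∃ i, ∀ j, pathHeight b j = pathHeight a j + if j = i then 1 else 0 := by
  cases h with
  | fill u v => exact ⟨_, pathHeight_append_H_eq_append_D_U u v⟩
  | raise u v => exact ⟨_, pathHeight_append_U_D u v⟩

theorem SchroderMove.length_pathIncrements_eq {a b : List SchroderStep} (h : SchroderMove a b) :
    (pathIncrements b).length = (pathIncrements a).length := by
  cases h <;> simp [pathIncrements_append, pathIncrements_cons, SchroderStep.increments]

theorem SchroderMove.sum_pathIncrements_eq {a b : List SchroderStep} (h : SchroderMove a b) :
    (pathIncrements b).sum = (pathIncrements a).sum := by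
  cases h <;> simp [pathIncrements_append, pathIncrements_cons, SchroderStep.increments]

theorem GrandSchroder.le_def {n : ℕ} {a b : GrandSchroder n} :
    a ≤ b ↔ ∀ i, pathHeight a.1 i ≤ pathHeight b.1 i := Iff.rfl

theorem SchroderMove.lt {n : ℕ} {a b : GrandSchroder n} (h : SchroderMove a.1 b.1) : a < b := by
  obtain ⟨i, hi⟩ := h.exists_pathHeight_eq
  refine lt_of_le_of_ne (fun j => ?_) ?_
  · rw [hi]; split_ifs <;> omega
  · rintro rfl
    simpa using hi i

/-- The heights of `a` and `b` differ by one at a single abscissa, so a path weakly between them has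
the heights of one of the two. -/
theorem SchroderMove.covBy {n : ℕ} {a b : GrandSchroder n} (h : SchroderMove a.1 b.1) :
    a ⋖ b := by
  refine ⟨h.lt, fun c hac hcb => ?_⟩
  obtain ⟨i, hi⟩ := h.exists_pathHeight_eq
  have h₁ := GrandSchroder.le_def.1 hac.le
  have h₂ := GrandSchroder.le_def.1 hcb.le
  by_cases hc : pathHeight c.1 i = pathHeight a.1 i
  · refine hac.ne (GrandSchroder.eq_of_height_eq a c fun j => ?_)
    have := h₁ j
    have := h₂ j
    have := hi j
    split_ifs at this with hj
    · rw [hj, hc]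
    · omega
  · refine hcb.ne (GrandSchroder.eq_of_height_eq c b fun j => ?_)
    have := h₁ j
    have := h₂ j
    have := hi j
    split_ifs at this with hj
    · subst hj; omega
    · omega

/-- A move of `a` at an abscissa where `a` is strictly below `b` stays weakly below `b`. -/
theorem GrandSchroder.exists_move_le_of_eq {n : ℕ} {a b : GrandSchroder n} (hab : a ≤ b)
    {w : List SchroderStep} (hw : SchroderMove a.1 w) {i : ℕ}
    (hi : ∀ j, pathHeight w j = pathHeight a.1 j + if j = i then 1 else 0)
    (hlt : pathHeight a.1 i < pathHeight b.1 i) :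
    ∃ c : GrandSchroder n, SchroderMove a.1 c.1 ∧ c ≤ b := by
  refine ⟨⟨w, hw.length_pathIncrements_eq.trans a.2.1, hw.sum_pathIncrements_eq.trans a.2.2⟩,
    hw, fun j => ?_⟩
  have := hab j
  change pathHeight w j ≤ _
  rw [hi]
  split_ifs with hj
  · subst hj; omega
  · omega

theorem GrandSchroder.exists_move_le_of_H {n : ℕ} {a b : GrandSchroder n} (hab : a ≤ b)
    {u v : List SchroderStep} (hw : a.1 = u ++ SchroderStep.H :: v)
    (hlt : pathHeight a.1 ((pathIncrements u).length + 1) <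
      pathHeight b.1 ((pathIncrements u).length + 1)) :
    ∃ c : GrandSchroder n, SchroderMove a.1 c.1 ∧ c ≤ b :=
  exists_move_le_of_eq hab (w := u ++ SchroderStep.U :: SchroderStep.D :: v)
    (hw ▸ SchroderMove.raise u v) (hw ▸ pathHeight_append_U_D u v) hlt

/-- Among the abscissas where `a` is strictly below `b`, take `i` with `a` lowest. Minimality
excludes a `D` leaving `i` and a `U` arriving at `i` after which `a` rises again. What remains is a
valley at `i`, or an `H` centred at `i`, `i + 1` or `i - 1`; in each case the move stays below `b`.
-/
theorem GrandSchroder.exists_move_le {n : ℕ} {a b : GrandSchroder n} (hab : a < b) :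
    ∃ c : GrandSchroder n, SchroderMove a.1 c.1 ∧ c ≤ b := by
  have hle := GrandSchroder.le_def.1 hab.le
  obtain ⟨i, hi, hmin⟩ : ∃ i, pathHeight a.1 i < pathHeight b.1 i ∧
      ∀ j, pathHeight a.1 j < pathHeight b.1 j → pathHeight a.1 i ≤ pathHeight a.1 j := by
    have hne : {i | pathHeight a.1 i < pathHeight b.1 i}.Nonempty := by
      by_contra hcon
      refine hab.ne (GrandSchroder.eq_of_height_eq a b fun j => le_antisymm (hle j) ?_)
      by_contra hj
      exact hcon ⟨j, not_le.1 hj⟩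
    have hfin : {i | pathHeight a.1 i < pathHeight b.1 i}.Finite := by
      refine (Set.finite_lt_nat (2 * n)).subset fun j hj => ?_
      by_contra hcon
      have hcon' : 2 * n ≤ j := not_lt.1 hcon
      simp [a.pathHeight_of_le hcon', b.pathHeight_of_le hcon'] at hj
    obtain ⟨i, hi, h⟩ := Set.exists_min_image _ (pathHeight a.1) hfin hne
    exact ⟨i, hi, h⟩
  have hi2 : i < 2 * n := by
    by_contra hcon
    simp [a.pathHeight_of_le (not_lt.1 hcon), b.pathHeight_of_le (not_lt.1 hcon)] at hi
  have hi0 : i ≠ 0 := by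
    rintro rfl
    simp [pathHeight_zero] at hi
  have hb1 := abs_le.1 (abs_pathHeight_succ_sub_le b.1 i)
  have hb0 := abs_le.1 (abs_pathHeight_succ_sub_le b.1 (i - 1))
  rw [Nat.sub_add_cancel (Nat.one_le_iff_ne_zero.2 hi0)] at hb0
  have hbodd := pathHeight_eq_of_odd (w := b.1) (i := i) (by rw [b.2.1]; omega)
  rcases exists_append_or_exists_append_H a.1 i (by rw [a.2.1]; omega) with
    ⟨u, v, hw, hu⟩ | ⟨u, v, hw, hu⟩
  · have hai : pathHeight a.1 i = (pathIncrements u).sum := by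
      rw [hw, ← hu, pathHeight_append_length]
    have heven := even_sum_add_length_pathIncrements u
    rw [hu, ← hai] at heven
    -- if `b` exceeds `a` by one at `i`, then `i` is the centre of a horizontal step of `b`
    have hodd : pathHeight b.1 i = pathHeight a.1 i + 1 →
        pathHeight b.1 (i + 1) = pathHeight b.1 i ∧
          pathHeight b.1 (i - 1) = pathHeight b.1 i := fun h => hbodd <| by
      rw [h, add_right_comm]; exact heven.add_one
    rcases v with _ | ⟨s, v⟩
    · rw [List.append_nil] at hw
      rw [← hw, a.2.1] at hu
      omega
    have hs := pathHeight_append_cons u v s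
    rw [← hw, ← hai, hu] at hs
    cases s with
    -- As `b` falls by at most one, `a` would still be strictly below `b` at `i + 1`, at a lower
    -- height.
    | D =>
      simp only [SchroderStep.increments, List.length_singleton, List.sum_singleton] at hs
      have := hmin (i + 1) (by omega)
      omega
    | H =>
      refine exists_move_le_of_H hab.le hw ?_
      have h := pathHeight_append_H u v
      rw [← hw, ← hai] at h
      rw [h, hu]
      omega
    | U =>
      rcases List.eq_nil_or_concat u with rfl | ⟨u, t, rfl⟩
      · exact absurd hu.symm hi0
      rw [List.concat_eq_append] at *
      rw [List.append_assoc, List.singleton_append] at hw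
      rw [pathIncrements_append, List.length_append, pathIncrements_singleton] at hu
      rw [pathIncrements_append, List.sum_append, pathIncrements_singleton] at hai
      have ht := pathHeight_append_length u (t :: SchroderStep.U :: v)
      rw [← hw] at ht
      cases t with
      | U =>
        simp only [SchroderStep.increments, List.length_singleton, List.sum_singleton] at hai hu
        rw [← hu, Nat.add_sub_cancel, hu] at hb0 hodd
        have := hmin (pathIncrements u).length (by omega)
        omega
      | D =>
        simp only [SchroderStep.increments, List.length_singleton, List.sum_singleton] at hai hu
        refine exists_move_le_of_eq hab.le (w := u ++ SchroderStep.H :: v)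
          (hw ▸ SchroderMove.fill u v) (hw ▸ pathHeight_append_H_eq_append_D_U u v) ?_
        rwa [hu]
      | H =>
        simp only [SchroderStep.increments, List.length_cons, List.length_nil, List.sum_cons,
          List.sum_nil] at hai hu
        -- Room at the centre `i - 1` of this `H`: a gap of at least two at `i` shrinks by at most
        -- one, and if the gap is exactly one then `b` is flat around `i` by parity.
        refine exists_move_le_of_H hab.le hw ?_
        have h := pathHeight_append_H u (SchroderStep.U :: v)
        rw [← hw] at h
        rw [h]
        obtain rfl : i = (pathIncrements u).length + 1 + 1 := by omega
        rw [Nat.add_sub_cancel] at hb0 hodd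
        omega
  · refine exists_move_le_of_H hab.le hw ?_
    rwa [hu]

theorem GrandSchroder.covBy_iff {n : ℕ} {a b : GrandSchroder n} :
    a ⋖ b ↔ SchroderMove a.1 b.1 := by
  refine ⟨fun h => ?_, SchroderMove.covBy⟩
  obtain ⟨c, hc, hcb⟩ := exists_move_le h.lt
  obtain rfl | hlt := eq_or_lt_of_le hcb
  · exact hc
  · exact absurd hlt (h.2 hc.lt)

/-! ### Counting words of steps -/

namespace SchroderStep

theorem length_pathIncrements_eq_count (w : List SchroderStep) :
    (pathIncrements w).length = w.count U + w.count D + 2 * w.count H := by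
  induction w with
  | nil => simp [pathIncrements]
  | cons s w ih =>
    rw [pathIncrements_cons, List.length_append, ih]
    cases s <;> simp [increments] <;> omega

theorem sum_pathIncrements_eq_count (w : List SchroderStep) :
    (pathIncrements w).sum = (w.count U : ℤ) - w.count D := by
  induction w with
  | nil => simp [pathIncrements]
  | cons s w ih =>
    rw [pathIncrements_cons, List.sum_append, ih]
    cases s <;> simp [increments] <;> omega

theorem length_eq_count (w : List SchroderStep) :
    w.length = w.count U + w.count D + w.count H := by
  induction w with
  | nil => simp
  | cons s w ih => cases s <;> simp <;> omega

/-- The words with `a` up steps, `b` down steps and `c` horizontal steps. -/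
def words (a b c : ℕ) : Set (List SchroderStep) :=
  {w | w.count U = a ∧ w.count D = b ∧ w.count H = c}

theorem words_finite (a b c : ℕ) : (words a b c).Finite :=
  (List.finite_length_le SchroderStep (a + b + c)).subset fun w ⟨h₁, h₂, h₃⟩ => by
    change w.length ≤ _
    rw [length_eq_count, h₁, h₂, h₃]

theorem ncard_setOf_cons {p : List SchroderStep → Prop} (hp : {w | p w}.Finite) :
    {w | p w ∧ w ≠ []}.ncard =
      {w | p (U :: w)}.ncard + {w | p (D :: w)}.ncard + {w | p (H :: w)}.ncard := by
  have hfin (s : SchroderStep) : (List.cons s '' {w | p (s :: w)}).Finite :=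
    hp.subset (by rintro _ ⟨w, hw, rfl⟩; exact hw)
  have hcard (s : SchroderStep) : (List.cons s '' {w | p (s :: w)}).ncard =
      {w | p (s :: w)}.ncard := Set.ncard_image_of_injective _ (List.cons_injective)
  have hdisj (s t : SchroderStep) (h : s ≠ t) :
      Disjoint (List.cons s '' {w | p (s :: w)}) (List.cons t '' {w | p (t :: w)}) := by
    rw [Set.disjoint_left]
    rintro _ ⟨w, -, rfl⟩ ⟨w', -, h'⟩
    exact h (List.cons.inj h').1.symm
  have hunion : {w | p w ∧ w ≠ []} = List.cons U '' {w | p (U :: w)} ∪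
      List.cons D '' {w | p (D :: w)} ∪ List.cons H '' {w | p (H :: w)} := by
    ext w
    rcases w with _ | ⟨s, w⟩
    · simp
    · cases s <;> simp
  rw [hunion, Set.ncard_union_eq _ ((hfin U).union (hfin D)) (hfin H),
    Set.ncard_union_eq (hdisj U D (by simp)) (hfin U) (hfin D), hcard, hcard, hcard]
  exact Set.disjoint_union_left.2 ⟨hdisj U H (by simp), hdisj D H (by simp)⟩

/-- The number of words with prescribed numbers of steps is a multinomial coefficient. -/
theorem ncard_words_mul_factorial (a b c : ℕ) :
    (words a b c).ncard * (a.factorial * b.factorial * c.factorial) = (a + b + c).factorial := by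
  obtain ⟨L, hL⟩ : ∃ L, a + b + c = L := ⟨_, rfl⟩
  rw [hL]
  induction L generalizing a b c with
  | zero =>
    obtain ⟨rfl, rfl, rfl⟩ : a = 0 ∧ b = 0 ∧ c = 0 := by omega
    have : words 0 0 0 = {[]} := by
      ext w
      refine ⟨fun ⟨h₁, h₂, h₃⟩ => ?_, ?_⟩
      · have := length_eq_count w
        exact List.length_eq_zero_iff.1 (by omega)
      · rintro rfl
        simp [words]
    simp [this]
  | succ L ih =>
    have h := ncard_setOf_cons (p := (· ∈ words a b c)) (words_finite a b c)
    have hne : {w | w ∈ words a b c ∧ w ≠ []} = words a b c := by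
      ext w
      refine ⟨fun h => h.1, fun h => ⟨h, ?_⟩⟩
      rintro rfl
      obtain ⟨h₁, h₂, h₃⟩ := h
      simp at h₁ h₂ h₃
      omega
    -- Words are sorted by their first letter; the three shares are proportional to `a`, `b`, `c`,
    -- which add up to `L + 1`.
    have hU : {w | U :: w ∈ words a b c}.ncard * (a.factorial * b.factorial * c.factorial) =
        a * L.factorial := by
      rcases a with _ | a
      · simp [words]
      · rw [← ih a b c (by omega), Nat.factorial_succ]
        have : {w | U :: w ∈ words (a + 1) b c} = words a b c := by ext w; simp [words]
        rw [this]; ring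
    have hD : {w | D :: w ∈ words a b c}.ncard * (a.factorial * b.factorial * c.factorial) =
        b * L.factorial := by
      rcases b with _ | b
      · simp [words]
      · rw [← ih a b c (by omega), Nat.factorial_succ]
        have : {w | D :: w ∈ words a (b + 1) c} = words a b c := by ext w; simp [words]
        rw [this]; ring
    have hH : {w | H :: w ∈ words a b c}.ncard * (a.factorial * b.factorial * c.factorial) =
        c * L.factorial := by
      rcases c with _ | c
      · simp [words]
      · rw [← ih a b c (by omega), Nat.factorial_succ]
        have : {w | H :: w ∈ words a b (c + 1)} = words a b c := by ext w; simp [words]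
        rw [this]; ring
    rw [← hne, h, add_mul, add_mul, hU, hD, hH, Nat.factorial_succ, ← hL]
    ring

theorem ncard_words_of_le {n k : ℕ} (hk : k ≤ n) :
    (words k k (n - k)).ncard = (n + k).choose (2 * k) * (2 * k).choose k := by
  have h := ncard_words_mul_factorial k k (n - k)
  have h₁ := Nat.choose_mul_factorial_mul_factorial (n := n + k) (k := 2 * k) (by omega)
  have h₂ := Nat.choose_mul_factorial_mul_factorial (n := 2 * k) (k := k) (by omega)
  rw [show k + k + (n - k) = n + k by omega, ← h₁, show n + k - 2 * k = n - k by omega, ← h₂,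
    show 2 * k - k = k by omega] at h
  refine Nat.eq_of_mul_eq_mul_right (m := k.factorial * k.factorial * (n - k).factorial)
    (by positivity) (h.trans (by ring))

/-- The number of ways to single out a horizontal step of a word. -/
theorem ncard_setOf_append_H_eq (w : List SchroderStep) :
    {p : List SchroderStep × List SchroderStep | p.1 ++ H :: p.2 = w}.ncard = w.count H ∧
      {p : List SchroderStep × List SchroderStep | p.1 ++ H :: p.2 = w}.Finite := by
  induction w with
  | nil => simp
  | cons s w ih =>
    have hinj : Function.Injective
        (fun p : List SchroderStep × List SchroderStep => (s :: p.1, p.2)) := by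
      rintro ⟨u, v⟩ ⟨u', v'⟩ h
      simpa using h
    have hunion : {p : List SchroderStep × List SchroderStep | p.1 ++ H :: p.2 = s :: w} =
        (fun p : List SchroderStep × List SchroderStep => (s :: p.1, p.2)) ''
          {p | p.1 ++ H :: p.2 = w} ∪ {p | p = ([], w) ∧ s = H} := by
      ext ⟨u, v⟩
      rcases u with _ | ⟨t, u⟩
      · simp [eq_comm, and_comm]
      · simp [eq_comm, and_comm]
    have hfin : {p : List SchroderStep × List SchroderStep | p = ([], w) ∧ s = H}.Finite :=
      (Set.finite_singleton ([], w)).subset fun p hp => hp.1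
    rw [hunion]
    refine ⟨?_, (ih.2.image _).union hfin⟩
    rw [Set.ncard_union_eq _ (ih.2.image _) hfin, Set.ncard_image_of_injective _ hinj, ih.1]
    · cases s <;> simp
    · rw [Set.disjoint_left]
      rintro _ ⟨p, -, rfl⟩ ⟨h, -⟩
      simp at h

end SchroderStep

open SchroderStep

/-! ### Counting paths, marked paths and covering pairs. -/

theorem mem_grandSchroder_iff {n : ℕ} {w : List SchroderStep} :
    ((pathIncrements w).length = 2 * n ∧ (pathIncrements w).sum = 0) ↔
      ∃ k ≤ n, w ∈ words k k (n - k) := by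
  rw [length_pathIncrements_eq_count, sum_pathIncrements_eq_count]
  constructor
  · rintro ⟨h₁, h₂⟩
    exact ⟨w.count U, by omega, rfl, by omega, by omega⟩
  · rintro ⟨k, hk, h₁, h₂, h₃⟩
    omega

/-- Sums over the Grand Schröder paths of functions of the number of up steps. -/
theorem GrandSchroder.sum_eq (n : ℕ) [Fintype (GrandSchroder n)] (f : ℕ → ℕ) :
    ∑ w : GrandSchroder n, f (w.1.count U) =
      ∑ k ∈ Finset.range (n + 1), (n + k).choose (2 * k) * (2 * k).choose k * f k := by
  classical
  rw [← Finset.sum_fiberwise_of_maps_to (t := Finset.range (n + 1))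
    (g := fun w : GrandSchroder n => w.1.count U)]
  · refine Finset.sum_congr rfl fun k hk => ?_
    have hk' : k ≤ n := Nat.lt_succ_iff.1 (Finset.mem_range.1 hk)
    rw [Finset.sum_congr rfl (g := fun _ => f k)
      (fun w hw => by rw [(Finset.mem_filter.1 hw).2]), Finset.sum_const, smul_eq_mul,
      ← ncard_words_of_le hk', ← Set.ncard_coe_finset,
      ← Set.ncard_image_of_injective _ (f := fun w : GrandSchroder n => w.1)
        fun _ _ => Subtype.ext]
    congr 2
    ext w
    simp only [Finset.coe_filter, Finset.mem_univ, true_and, Set.mem_image, Set.mem_ofPred_eq]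
    constructor
    · rintro ⟨w, h, rfl⟩
      obtain ⟨j, hj, hw⟩ := mem_grandSchroder_iff.1 w.2
      obtain rfl : j = k := hw.1.symm.trans h
      exact hw
    · intro h
      exact ⟨⟨w, mem_grandSchroder_iff.2 ⟨k, hk', h⟩⟩, h.1, rfl⟩
  · intro w _
    obtain ⟨j, hj, hw⟩ := mem_grandSchroder_iff.1 w.2
    rw [Finset.mem_range, hw.1]
    omega

theorem GrandSchroder.card_eq (n : ℕ) :
    Nat.card (GrandSchroder n) =
      ∑ k ∈ Finset.range (n + 1), (n + k).choose (2 * k) * (2 * k).choose k := by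
  have := Fintype.ofFinite (GrandSchroder n)
  simpa using GrandSchroder.sum_eq n fun _ => 1

/-- The Grand Schröder paths with a distinguished horizontal step, cut at this step. -/
abbrev MarkedGrandSchroder (n : ℕ) : Type :=
  {p : List SchroderStep × List SchroderStep //
    (pathIncrements (p.1 ++ H :: p.2)).length = 2 * n ∧
      (pathIncrements (p.1 ++ H :: p.2)).sum = 0}

/-- The fibre over a path with `k` up steps has one element per horizontal step, hence `n - k`
elements. -/
theorem MarkedGrandSchroder.card_eq (n : ℕ) :
    Nat.card (MarkedGrandSchroder n) =
      ∑ k ∈ Finset.range (n + 1), (n + k).choose (2 * k) * (2 * k).choose k * (n - k) := by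
  have := Fintype.ofFinite (GrandSchroder n)
  have e : MarkedGrandSchroder n ≃ Σ w : GrandSchroder n,
      {p : List SchroderStep × List SchroderStep // p.1 ++ H :: p.2 = w.1} :=
    { toFun := fun p => ⟨⟨_, p.2⟩, p.1, rfl⟩
      invFun := fun q => ⟨q.2.1, by rw [q.2.2]; exact q.1.2⟩
      left_inv := fun _ => rfl
      right_inv := by rintro ⟨⟨w, hw⟩, p, hp⟩; obtain rfl : _ = w := hp; rfl }
  have hfin (w : GrandSchroder n) :
      Finite {p : List SchroderStep × List SchroderStep // p.1 ++ H :: p.2 = w.1} :=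
    (ncard_setOf_append_H_eq w.1).2.to_subtype
  rw [Nat.card_congr e, Nat.card_sigma, ← GrandSchroder.sum_eq n fun k => n - k]
  refine Finset.sum_congr rfl fun w _ => ?_
  refine ((ncard_setOf_append_H_eq w.1).1).trans ?_
  obtain ⟨j, hj, hw⟩ := mem_grandSchroder_iff.1 w.2
  rw [hw.1, hw.2.2]

/-- If one prefix were shorter, the letter of the longer one at that place would be both `H` and
`s`. Hence the two ends of a move determine where it takes place. -/
theorem List.append_H_injective {u v u' v' : List SchroderStep} {s t : SchroderStep}
    (hs : s ≠ H) (h : u ++ H :: v = u' ++ H :: v')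
    (h' : u ++ s :: t :: v = u' ++ s :: t :: v') : u = u' ∧ v = v' := by
  induction u generalizing u' with
  | nil =>
    rcases u' with _ | ⟨x, u'⟩
    · simpa using h
    · simp only [List.nil_append, List.cons_append, List.cons.injEq] at h h'
      exact absurd (h'.1.trans h.1.symm) hs
  | cons x u ih =>
    rcases u' with _ | ⟨y, u'⟩
    · simp only [List.nil_append, List.cons_append, List.cons.injEq] at h h'
      exact absurd (h'.1.symm.trans h.1) hs
    · simp only [List.cons_append, List.cons.injEq] at h h'
      obtain ⟨rfl, rfl⟩ := ih h.2 h'.2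
      exact ⟨by rw [h.1], rfl⟩

/-- Each covering pair arises either by filling a valley or by raising a horizontal step, and both
kinds are indexed by the paths with a distinguished horizontal step. -/
noncomputable def GrandSchroder.markedSumEquivCovBy (n : ℕ) :
    MarkedGrandSchroder n ⊕ MarkedGrandSchroder n ≃
      {p : GrandSchroder n × GrandSchroder n // p.1 ⋖ p.2} := by
  refine Equiv.ofBijective (Sum.elim
    (fun p => ⟨(⟨p.1.1 ++ D :: U :: p.1.2, ?_⟩, ⟨p.1.1 ++ H :: p.1.2, p.2⟩),
      GrandSchroder.covBy_iff.2 (SchroderMove.fill p.1.1 p.1.2)⟩)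
    (fun p => ⟨(⟨p.1.1 ++ H :: p.1.2, p.2⟩, ⟨p.1.1 ++ U :: D :: p.1.2, ?_⟩),
      GrandSchroder.covBy_iff.2 (SchroderMove.raise p.1.1 p.1.2)⟩)) ⟨?_, ?_⟩
  · have h := SchroderMove.fill p.1.1 p.1.2
    rw [← h.length_pathIncrements_eq, ← h.sum_pathIncrements_eq]
    exact p.2
  · have h := SchroderMove.raise p.1.1 p.1.2
    rw [h.length_pathIncrements_eq, h.sum_pathIncrements_eq]
    exact p.2
  · rintro (⟨⟨u, v⟩, h⟩ | ⟨⟨u, v⟩, h⟩) (⟨⟨u', v'⟩, h'⟩ | ⟨⟨u', v'⟩, h'⟩) heq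
    · have h₁ := congrArg (fun p => p.1.1.1) heq
      have h₂ := congrArg (fun p => p.1.2.1) heq
      obtain ⟨rfl, rfl⟩ := List.append_H_injective (by simp) h₂ h₁
      rfl
    -- Filling a valley increases the number of `H` and raising an `H` decreases it, so the two
    -- kinds of pairs never coincide.
    · have h₁ := congrArg (fun p => p.1.1.1.count H) heq
      have h₂ := congrArg (fun p => p.1.2.1.count H) heq
      simp only [Sum.elim_inl, Sum.elim_inr, List.count_append, List.count_cons] at h₁ h₂
      simp at h₁ h₂
      omega
    · have h₁ := congrArg (fun p => p.1.1.1.count H) heq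
      have h₂ := congrArg (fun p => p.1.2.1.count H) heq
      simp only [Sum.elim_inl, Sum.elim_inr, List.count_append, List.count_cons] at h₁ h₂
      simp at h₁ h₂
      omega
    · have h₁ := congrArg (fun p => p.1.1.1) heq
      have h₂ := congrArg (fun p => p.1.2.1) heq
      obtain ⟨rfl, rfl⟩ := List.append_H_injective (by simp) h₁ h₂
      rfl
  · rintro ⟨⟨⟨a, ha⟩, ⟨b, hb⟩⟩, hab⟩
    have hm : SchroderMove a b := GrandSchroder.covBy_iff.1 hab
    cases hm with
    | fill u v => exact ⟨Sum.inl ⟨(u, v), hb⟩, rfl⟩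
    | raise u v => exact ⟨Sum.inr ⟨(u, v), ha⟩, rfl⟩

theorem GrandSchroder.hasseEdgeCount_eq (n : ℕ) :
    hasseEdgeCount (GrandSchroder n) =
      2 * ∑ k ∈ Finset.range (n + 1), (n + k).choose (2 * k) * (2 * k).choose k * (n - k) := by
  have hfin := Finite.of_equiv _ (markedSumEquivCovBy n).symm
  have : Finite (MarkedGrandSchroder n) :=
    Finite.of_injective (Sum.inl : _ → MarkedGrandSchroder n ⊕ MarkedGrandSchroder n)
      Sum.inl_injective
  rw [hasseEdgeCount, ← Nat.card_congr (markedSumEquivCovBy n), Nat.card_sum,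
    MarkedGrandSchroder.card_eq, two_mul]

theorem GrandSchroder.cast_hasseEdgeCount_eq (n : ℕ) :
    (hasseEdgeCount (GrandSchroder n) : ℚ) =
      2 * ∑ k ∈ Finset.range (n + 1),
        ((n + k).choose (2 * k) : ℚ) * ((2 * k).choose k : ℚ) * ((n : ℚ) - (k : ℚ)) := by
  rw [hasseEdgeCount_eq]
  push_cast
  congr 1
  refine Finset.sum_congr rfl fun k hk => ?_
  rw [Nat.cast_sub (Nat.lt_succ_iff.1 (Finset.mem_range.1 hk))]

/-! ### Power series -/

namespace PowerSeries

/-- Terms with `k > n` vanish because `X ^ k` divides `t ^ k`. The factor `u` is kept inside so that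
a prefactor `geom a ^ d` merges with the powers of `geom a` in `t ^ k`. -/
theorem coeff_mul_subst {t : ℚ⟦X⟧} (ht : constantCoeff t = 0) (u f : ℚ⟦X⟧) (n : ℕ) :
    coeff n (u * f.subst t) =
      ∑ k ∈ Finset.range (n + 1), coeff k f * coeff n (u * t ^ k) := by
  have hvanish {j k : ℕ} (h : j < k) : coeff j (t ^ k) = 0 :=
    X_pow_dvd_iff.1 (pow_dvd_pow_of_dvd (X_dvd_iff.2 ht) k) j h
  have hcoeff (j : ℕ) (hj : j ≤ n) : coeff j (f.subst t) =
      ∑ k ∈ Finset.range (n + 1), coeff k f * coeff j (t ^ k) := by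
    rw [coeff_subst' (HasSubst.of_constantCoeff_zero' ht)]
    simp only [smul_eq_mul]
    refine finsum_eq_sum_of_support_subset _ fun k hk => ?_
    rw [Finset.coe_range, Set.mem_Iio]
    by_contra hcon
    exact hk (by simp only [hvanish (show j < k by omega), mul_zero])
  rw [coeff_mul, Finset.sum_congr rfl fun p hp => by
    rw [hcoeff p.2 (Finset.HasAntidiagonal.mem_antidiagonal.1 hp ▸ Nat.le_add_left _ _)]]
  simp_rw [Finset.mul_sum]
  rw [Finset.sum_comm]
  refine Finset.sum_congr rfl fun k _ => ?_
  rw [coeff_mul, Finset.mul_sum]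
  exact Finset.sum_congr rfl fun p _ => by ring

theorem constantCoeff_subst_of_zero {t : ℚ⟦X⟧} (ht : constantCoeff t = 0) (f : ℚ⟦X⟧) :
    constantCoeff (f.subst t) = constantCoeff f := by
  simpa using coeff_mul_subst ht 1 f 0

theorem eq_of_sq_eq_sq_of_constantCoeff {f g : ℚ⟦X⟧} (h : f ^ 2 = g ^ 2)
    (hf : constantCoeff f = 1) (hg : constantCoeff g = 1) : f = g := by
  rcases sq_eq_sq_iff_eq_or_eq_neg.1 h with h | h
  · exact h
  · rw [h, map_neg, hg] at hf
    norm_num at hf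

theorem eq_one_of_derivative_eq_zero {f : ℚ⟦X⟧} (h : d⁄dX ℚ f = 0) (h₀ : constantCoeff f = 1) :
    f = 1 :=
  derivative.ext (by rw [h, derivative_one]) (by simp [h₀])

/-- The geometric series `1 / (1 - a X)`. -/
noncomputable def geom (a : ℚ) : ℚ⟦X⟧ := rescale a (mk 1)

theorem geom_mul (a : ℚ) : geom a * (1 - C a * X) = 1 := by
  have := congrArg (rescale a) (mk_one_mul_one_sub_eq_one ℚ)
  simpa [geom, rescale_X] using this

theorem constantCoeff_geom (a : ℚ) : constantCoeff (geom a) = 1 := by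
  rw [← coeff_zero_eq_constantCoeff_apply, geom, coeff_rescale]
  simp

theorem coeff_geom_pow (a : ℚ) (d n : ℕ) :
    coeff n (geom a ^ (d + 1)) = a ^ n * ((d + n).choose d : ℚ) := by
  rw [geom, ← map_pow, mk_one_pow_eq_mk_choose_add, coeff_rescale, coeff_mk]

/-- The generating series `(1 - 4 X) ^ (-1/2)` of the central binomial coefficients. -/
noncomputable def centralBinomSeries : ℚ⟦X⟧ := mk fun k => (k.centralBinom : ℚ)

/-- The series `(1 - 4 X) ^ (-3/2)`. -/
noncomputable def centralBinomSeries₃ : ℚ⟦X⟧ := mk fun k => (2 * k + 1 : ℚ) * (k.centralBinom : ℚ)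

theorem constantCoeff_centralBinomSeries : constantCoeff centralBinomSeries = 1 := by
  rw [← coeff_zero_eq_constantCoeff_apply, centralBinomSeries, coeff_mk]
  simp

theorem constantCoeff_centralBinomSeries₃ : constantCoeff centralBinomSeries₃ = 1 := by
  rw [← coeff_zero_eq_constantCoeff_apply, centralBinomSeries₃, coeff_mk]
  simp

theorem cast_succ_mul_centralBinom_succ (k : ℕ) :
    ((k : ℚ) + 1) * ((k + 1).centralBinom : ℚ) = 2 * (2 * k + 1) * (k.centralBinom : ℚ) := by
  exact_mod_cast Nat.succ_mul_centralBinom_succ k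

theorem derivative_centralBinomSeries_mul :
    d⁄dX ℚ centralBinomSeries * (1 - 4 * X) = 2 * centralBinomSeries := by
  have h4 : (4 : ℚ⟦X⟧) = C 4 := (map_ofNat C 4).symm
  have h2 : (2 : ℚ⟦X⟧) = C 2 := (map_ofNat C 2).symm
  ext n
  rw [mul_sub, mul_one, h4, h2, mul_left_comm, map_sub, coeff_C_mul, coeff_C_mul,
    coeff_derivative]
  rcases n with _ | n
  · have := cast_succ_mul_centralBinom_succ 0
    simpa [centralBinomSeries] using this
  · have := cast_succ_mul_centralBinom_succ (n + 1)
    rw [coeff_succ_mul_X, coeff_derivative]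
    simp only [centralBinomSeries, coeff_mk]
    push_cast at this ⊢
    linear_combination this

/-- The differential equation `(1 - 4X) y' = 2y` makes the derivative of `y² (1 - 4X)` vanish. -/
theorem centralBinomSeries_sq_mul : centralBinomSeries ^ 2 * (1 - 4 * X) = 1 := by
  refine eq_one_of_derivative_eq_zero ?_ ?_
  · have h4 : (4 : ℚ⟦X⟧) = C 4 := (map_ofNat C 4).symm
    have h : d⁄dX ℚ (1 - 4 * X : ℚ⟦X⟧) = -4 := by
      rw [h4]; simp [Derivation.leibniz]
    rw [Derivation.leibniz, Derivation.leibniz_pow, h]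
    simp only [smul_eq_mul, nsmul_eq_mul]
    push_cast
    linear_combination 2 * centralBinomSeries * derivative_centralBinomSeries_mul
  · simp [constantCoeff_centralBinomSeries]

theorem centralBinomSeries₃_mul :
    centralBinomSeries₃ * (1 - 4 * X) = centralBinomSeries := by
  have h : centralBinomSeries₃ = 2 * X * d⁄dX ℚ centralBinomSeries + centralBinomSeries := by
    have h2 : (2 : ℚ⟦X⟧) = C 2 := (map_ofNat C 2).symm
    ext n
    rw [h2, mul_assoc, map_add, coeff_C_mul]
    rcases n with _ | n
    · simp [centralBinomSeries, centralBinomSeries₃]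
    · rw [coeff_succ_X_mul, coeff_derivative]
      simp only [centralBinomSeries, centralBinomSeries₃, coeff_mk]
      push_cast
      ring
  rw [h]
  linear_combination 2 * X * derivative_centralBinomSeries_mul

theorem centralBinomSeries₃_sq_mul : centralBinomSeries₃ ^ 2 * (1 - 4 * X) ^ 3 = 1 := by
  linear_combination centralBinomSeries_sq_mul + (1 - 4 * X) *
    (centralBinomSeries₃ * (1 - 4 * X) + centralBinomSeries) * centralBinomSeries₃_mul

section Subst

variable {t : ℚ⟦X⟧}

theorem subst_one_sub_four_mul_X (ht : constantCoeff t = 0) :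
    (1 - 4 * X : ℚ⟦X⟧).subst t = 1 - 4 * t := by
  have h := HasSubst.of_constantCoeff_zero' ht
  rw [← coe_substAlgHom h, map_sub, map_mul, map_one, map_ofNat, substAlgHom_X h]

theorem centralBinomSeries_subst_sq_mul (ht : constantCoeff t = 0) :
    centralBinomSeries.subst t ^ 2 * (1 - 4 * t) = 1 := by
  have h := HasSubst.of_constantCoeff_zero' ht
  have := congrArg (substAlgHom (R := ℚ) h) centralBinomSeries_sq_mul
  rw [map_mul, map_pow, map_one, coe_substAlgHom, subst_one_sub_four_mul_X ht] at this
  exact this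

theorem centralBinomSeries₃_subst_sq_mul (ht : constantCoeff t = 0) :
    centralBinomSeries₃.subst t ^ 2 * (1 - 4 * t) ^ 3 = 1 := by
  have h := HasSubst.of_constantCoeff_zero' ht
  have := congrArg (substAlgHom (R := ℚ) h) centralBinomSeries₃_sq_mul
  rw [map_mul, map_pow, map_pow, map_one, coe_substAlgHom, subst_one_sub_four_mul_X ht] at this
  exact this

end Subst

/-! ### Half-integral powers of `1 - 6 X + X ^ 2` -/

theorem ratPow_three_halves_sq {f : ℚ⟦X⟧} (hf : constantCoeff f = 1) :
    ratPow f (3 / 2) ^ 2 = f ^ 3 := by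
  have h : HasSubst (f - 1) := HasSubst.of_constantCoeff_zero' (by simp [hf])
  have h3 : binomialSeries ℚ (3 / 2 : ℚ) * binomialSeries ℚ (3 / 2 : ℚ) = (1 + X : ℚ⟦X⟧) ^ 3 := by
    rw [← binomialSeries_add, ← binomialSeries_nat (R := ℚ)]
    norm_num
  rw [ratPow, sq, ← subst_mul h, h3, ← coe_substAlgHom h, map_pow, map_add, map_one,
    substAlgHom_X h, add_sub_cancel]

theorem constantCoeff_ratPow {f : ℚ⟦X⟧} (hf : constantCoeff f = 1) (a : ℚ) :
    constantCoeff (ratPow f a) = 1 := by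
  rw [ratPow, constantCoeff_subst_of_zero (t := f - 1) (by simp [hf]), binomialSeries_constantCoeff]

/-- The series `(1 - 6 X + X ^ 2) ^ (-1/2)`, expanded along powers of `X / (1 - X) ^ 2`. -/
noncomputable def delannoySeries : ℚ⟦X⟧ :=
  geom 1 * centralBinomSeries.subst (X * geom 1 ^ 2)

/-- The series `(1 - X) (1 - 6 X + X ^ 2) ^ (-3/2)`, expanded along powers of `X / (1 - X) ^ 2`. -/
noncomputable def halfEdgeSeries : ℚ⟦X⟧ :=
  geom 1 ^ 2 * centralBinomSeries₃.subst (X * geom 1 ^ 2)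

/-- The series `(1 - 6 X + X ^ 2) ^ (-1/2)`, expanded along powers of `2 X ^ 2 / (1 - 3 X) ^ 2`. -/
noncomputable def delannoySeries' : ℚ⟦X⟧ :=
  geom 3 * centralBinomSeries.subst (C 2 * X ^ 2 * geom 3 ^ 2)

/-- The series `(1 - 6 X + X ^ 2) ^ (-3/2)`, expanded along powers of `2 X ^ 2 / (1 - 3 X) ^ 2`. -/
noncomputable def delannoySeries₃ : ℚ⟦X⟧ :=
  geom 3 ^ 3 * centralBinomSeries₃.subst (C 2 * X ^ 2 * geom 3 ^ 2)

theorem constantCoeff_X_mul_geom : constantCoeff (X * geom 1 ^ 2) = 0 := by simp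

theorem constantCoeff_C_mul_X_sq_mul_geom :
    constantCoeff (C 2 * X ^ 2 * geom 3 ^ 2) = 0 := by simp

theorem coeff_delannoySeries (n : ℕ) :
    coeff n delannoySeries =
      ∑ k ∈ Finset.range (n + 1), ((n + k).choose (2 * k) : ℚ) * ((2 * k).choose k : ℚ) := by
  rw [delannoySeries, coeff_mul_subst constantCoeff_X_mul_geom]
  refine Finset.sum_congr rfl fun k hk => ?_
  have hk' : k ≤ n := Nat.lt_succ_iff.1 (Finset.mem_range.1 hk)
  rw [show geom 1 * (X * geom 1 ^ 2) ^ k = X ^ k * geom 1 ^ (2 * k + 1) by ring,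
    coeff_X_pow_mul', if_pos hk', coeff_geom_pow, centralBinomSeries, coeff_mk,
    Nat.centralBinom_eq_two_mul_choose, show 2 * k + (n - k) = n + k by omega]
  ring

theorem coeff_delannoySeries' (n : ℕ) :
    coeff n delannoySeries' =
      ∑ k ∈ Finset.range (n + 1),
        (n.choose (2 * k) : ℚ) * (k.centralBinom : ℚ) * 2 ^ k * 3 ^ (n - 2 * k) := by
  rw [delannoySeries', coeff_mul_subst constantCoeff_C_mul_X_sq_mul_geom]
  refine Finset.sum_congr rfl fun k _ => ?_
  rw [show geom 3 * (C 2 * X ^ 2 * geom 3 ^ 2) ^ k =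
      C 2 ^ k * (X ^ (2 * k) * geom 3 ^ (2 * k + 1)) by ring,
    ← map_pow, coeff_C_mul, coeff_X_pow_mul', centralBinomSeries, coeff_mk]
  split_ifs with h
  · rw [coeff_geom_pow, show 2 * k + (n - 2 * k) = n by omega]
    ring
  · rw [Nat.choose_eq_zero_of_lt (by omega)]
    simp

/-- Terms with `2k > n` vanish, so `N` is left free: two consecutive coefficients can then be summed
over a common range. -/
theorem coeff_delannoySeries₃ {n N : ℕ} (hN : n < 2 * N) :
    coeff n delannoySeries₃ =
      ∑ k ∈ Finset.range N, ((n + 2).choose (2 * k + 2) : ℚ) *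
        ((2 * k + 1) * (k.centralBinom : ℚ)) * 2 ^ k * 3 ^ (n - 2 * k) := by
  have hsum (M : ℕ) (hM : n / 2 + 1 ≤ M) := Finset.eventually_constant_sum
    (u := fun k => ((n + 2).choose (2 * k + 2) : ℚ) *
        ((2 * k + 1) * (k.centralBinom : ℚ)) * 2 ^ k * 3 ^ (n - 2 * k)) (N := n / 2 + 1)
    (fun k hk => by rw [Nat.choose_eq_zero_of_lt (by omega)]; simp) hM
  rw [hsum N (by omega), ← hsum (n + 1) (by omega)]
  rw [delannoySeries₃, coeff_mul_subst constantCoeff_C_mul_X_sq_mul_geom]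
  refine Finset.sum_congr rfl fun k _ => ?_
  rw [show geom 3 ^ 3 * (C 2 * X ^ 2 * geom 3 ^ 2) ^ k =
      C 2 ^ k * (X ^ (2 * k) * geom 3 ^ (2 * k + 2 + 1)) by ring,
    ← map_pow, coeff_C_mul, coeff_X_pow_mul', centralBinomSeries₃, coeff_mk]
  split_ifs with h
  · rw [coeff_geom_pow, show 2 * k + 2 + (n - 2 * k) = n + 2 by omega]
    ring
  · rw [Nat.choose_eq_zero_of_lt (by omega)]
    simp

/-- Rests on `(2k+1) C(n+k, 2k+1) = (n-k) C(n+k, 2k)`, where the left side comes from the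
coefficients of `(1-4X)^(-3/2)`. -/
theorem coeff_X_mul_halfEdgeSeries (n : ℕ) :
    coeff n (X * halfEdgeSeries) =
      ∑ k ∈ Finset.range (n + 1),
        ((n + k).choose (2 * k) : ℚ) * ((2 * k).choose k : ℚ) * ((n : ℚ) - (k : ℚ)) := by
  rw [halfEdgeSeries, ← mul_assoc, coeff_mul_subst constantCoeff_X_mul_geom]
  refine Finset.sum_congr rfl fun k hk => ?_
  have hk' : k ≤ n := Nat.lt_succ_iff.1 (Finset.mem_range.1 hk)
  rw [show X * geom 1 ^ 2 * (X * geom 1 ^ 2) ^ k = X ^ (k + 1) * geom 1 ^ (2 * k + 1 + 1) by ring,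
    coeff_X_pow_mul', centralBinomSeries₃, coeff_mk, Nat.centralBinom_eq_two_mul_choose]
  split_ifs with h
  · rw [coeff_geom_pow, show 2 * k + 1 + (n - (k + 1)) = n + k by omega]
    have := Nat.choose_succ_right_eq (n + k) (2 * k)
    rw [show n + k - 2 * k = n - k by omega] at this
    have h' := congrArg (Nat.cast (R := ℚ)) this
    push_cast [Nat.cast_sub hk'] at h'
    rw [one_pow]
    linear_combination ((2 * k).choose k : ℚ) * h'
  · obtain rfl : k = n := by omega
    simp

/-! ### Algebraic and differential relations between the series. -/

theorem geom_one_mul : geom 1 * (1 - X) = 1 := by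
  simpa using geom_mul 1

theorem geom_three_mul : geom 3 * (1 - 3 * X) = 1 := by
  have h := geom_mul 3
  rwa [map_ofNat] at h

theorem delannoySeries_sq_mul : delannoySeries ^ 2 * (1 - 6 * X + X ^ 2) = 1 := by
  have h := centralBinomSeries_subst_sq_mul constantCoeff_X_mul_geom
  -- This is `1 - 6X + X² = (1 - X)² - 4X` divided by `(1 - X)²`.
  have hT : geom 1 ^ 2 * (1 - 6 * X + X ^ 2) = 1 - 4 * (X * geom 1 ^ 2) := by
    linear_combination (geom 1 * (1 - X) + 1) * geom_one_mul
  rw [delannoySeries]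
  linear_combination h + centralBinomSeries.subst (X * geom 1 ^ 2) ^ 2 * hT

theorem halfEdgeSeries_sq_mul :
    halfEdgeSeries ^ 2 * (1 - 6 * X + X ^ 2) ^ 3 = (1 - X) ^ 2 := by
  have h := centralBinomSeries₃_subst_sq_mul constantCoeff_X_mul_geom
  have hT : geom 1 ^ 2 * (1 - 6 * X + X ^ 2) = 1 - 4 * (X * geom 1 ^ 2) := by
    linear_combination (geom 1 * (1 - X) + 1) * geom_one_mul
  have hg : (1 - X) ^ 2 * geom 1 ^ 2 = 1 := by
    linear_combination (geom 1 * (1 - X) + 1) * geom_one_mul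
  rw [← hT] at h
  rw [halfEdgeSeries]
  linear_combination (1 - X) ^ 2 * h - geom 1 ^ 4 *
    centralBinomSeries₃.subst (X * geom 1 ^ 2) ^ 2 * (1 - 6 * X + X ^ 2) ^ 3 * hg

theorem delannoySeries'_sq_mul : delannoySeries' ^ 2 * (1 - 6 * X + X ^ 2) = 1 := by
  have h := centralBinomSeries_subst_sq_mul constantCoeff_C_mul_X_sq_mul_geom
  have h2 : (C 2 : ℚ⟦X⟧) = 2 := map_ofNat C 2
  -- This is `1 - 6X + X² = (1 - 3X)² - 8X²` divided by `(1 - 3X)²`.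
  have hT : geom 3 ^ 2 * (1 - 6 * X + X ^ 2) = 1 - 4 * (C 2 * X ^ 2 * geom 3 ^ 2) := by
    rw [h2]
    linear_combination (geom 3 * (1 - 3 * X) + 1) * geom_three_mul
  rw [delannoySeries']
  linear_combination h + centralBinomSeries.subst (C 2 * X ^ 2 * geom 3 ^ 2) ^ 2 * hT

theorem delannoySeries₃_sq_mul : delannoySeries₃ ^ 2 * (1 - 6 * X + X ^ 2) ^ 3 = 1 := by
  have h := centralBinomSeries₃_subst_sq_mul constantCoeff_C_mul_X_sq_mul_geom
  have h2 : (C 2 : ℚ⟦X⟧) = 2 := map_ofNat C 2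
  have hT : geom 3 ^ 2 * (1 - 6 * X + X ^ 2) = 1 - 4 * (C 2 * X ^ 2 * geom 3 ^ 2) := by
    rw [h2]
    linear_combination (geom 3 * (1 - 3 * X) + 1) * geom_three_mul
  rw [← hT] at h
  rw [delannoySeries₃]
  linear_combination h

theorem constantCoeff_delannoySeries : constantCoeff delannoySeries = 1 := by
  rw [delannoySeries, map_mul, constantCoeff_geom,
    constantCoeff_subst_of_zero constantCoeff_X_mul_geom, constantCoeff_centralBinomSeries, mul_one]

theorem constantCoeff_halfEdgeSeries : constantCoeff halfEdgeSeries = 1 := by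
  rw [halfEdgeSeries, map_mul, map_pow, constantCoeff_geom,
    constantCoeff_subst_of_zero constantCoeff_X_mul_geom, constantCoeff_centralBinomSeries₃]
  norm_num

theorem constantCoeff_delannoySeries' : constantCoeff delannoySeries' = 1 := by
  rw [delannoySeries', map_mul, constantCoeff_geom,
    constantCoeff_subst_of_zero constantCoeff_C_mul_X_sq_mul_geom,
    constantCoeff_centralBinomSeries, mul_one]

theorem constantCoeff_delannoySeries₃ : constantCoeff delannoySeries₃ = 1 := by
  rw [delannoySeries₃, map_mul, map_pow, constantCoeff_geom,
    constantCoeff_subst_of_zero constantCoeff_C_mul_X_sq_mul_geom,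
    constantCoeff_centralBinomSeries₃]
  norm_num

theorem constantCoeff_one_sub_six_mul_X_add_X_sq :
    constantCoeff (1 - 6 * X + X ^ 2 : ℚ⟦X⟧) = 1 := by simp

theorem one_sub_six_mul_X_add_X_sq_ne_zero : (1 - 6 * X + X ^ 2 : ℚ⟦X⟧) ≠ 0 := fun h => by
  have := constantCoeff_one_sub_six_mul_X_add_X_sq
  rw [h, map_zero] at this
  exact zero_ne_one this

theorem delannoySeries'_eq : delannoySeries' = delannoySeries :=
  eq_of_sq_eq_sq_of_constantCoeff
    (mul_right_cancel₀ one_sub_six_mul_X_add_X_sq_ne_zero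
      (delannoySeries'_sq_mul.trans delannoySeries_sq_mul.symm))
    constantCoeff_delannoySeries' constantCoeff_delannoySeries

theorem halfEdgeSeries_eq : halfEdgeSeries = (1 - X) * delannoySeries₃ := by
  refine eq_of_sq_eq_sq_of_constantCoeff
    (mul_right_cancel₀ (pow_ne_zero 3 one_sub_six_mul_X_add_X_sq_ne_zero) ?_)
    constantCoeff_halfEdgeSeries (by simp [constantCoeff_delannoySeries₃])
  linear_combination halfEdgeSeries_sq_mul - (1 - X) ^ 2 * delannoySeries₃_sq_mul

theorem halfEdgeSeries_mul : halfEdgeSeries * (1 - 6 * X + X ^ 2) = (1 - X) * delannoySeries := by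
  refine eq_of_sq_eq_sq_of_constantCoeff
    (mul_right_cancel₀ one_sub_six_mul_X_add_X_sq_ne_zero ?_)
    (by simp [constantCoeff_halfEdgeSeries]) (by simp [constantCoeff_delannoySeries])
  linear_combination halfEdgeSeries_sq_mul - (1 - X) ^ 2 * delannoySeries_sq_mul

theorem delannoySeries₃_eq_inv :
    delannoySeries₃ = (ratPow (1 - 6 * X + X ^ 2) (3 / 2))⁻¹ := by
  have h₀ := constantCoeff_ratPow constantCoeff_one_sub_six_mul_X_add_X_sq (3 / 2)
  rw [PowerSeries.eq_inv_iff_mul_eq_one (by rw [h₀]; exact one_ne_zero)]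
  refine eq_of_sq_eq_sq_of_constantCoeff ?_ (by simp [h₀, constantCoeff_delannoySeries₃])
    (by simp)
  rw [mul_pow, ratPow_three_halves_sq constantCoeff_one_sub_six_mul_X_add_X_sq,
    delannoySeries₃_sq_mul, one_pow]

theorem derivative_delannoySeries_mul :
    d⁄dX ℚ delannoySeries * (1 - 6 * X + X ^ 2) = (3 - X) * delannoySeries := by
  have h6 : (6 : ℚ⟦X⟧) = C 6 := (map_ofNat C 6).symm
  have hT : d⁄dX ℚ (1 - 6 * X + X ^ 2 : ℚ⟦X⟧) = 2 * X - 6 := by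
    rw [h6]
    simp [Derivation.leibniz, Derivation.leibniz_pow]
    ring
  have h := congrArg (d⁄dX ℚ) delannoySeries_sq_mul
  rw [Derivation.leibniz, Derivation.leibniz_pow, hT, derivative_one] at h
  simp only [smul_eq_mul, nsmul_eq_mul] at h
  push_cast at h
  have h0 : (2 : ℚ⟦X⟧) * delannoySeries ≠ 0 := by
    intro h0
    have := congrArg constantCoeff h0
    rw [map_mul, constantCoeff_delannoySeries] at this
    rw [map_ofNat] at this
    norm_num at this
  refine mul_left_cancel₀ h0 ?_
  linear_combination h

/-- After multiplication by `T = 1 - 6X + X²` every term is a multiple of `delannoySeries`, and the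
claim becomes `4X(1 - X) = 3T + (7X - 1)(3 - X)`. Its coefficients express edge counts through two
consecutive cardinals. -/
theorem four_mul_X_mul_halfEdgeSeries :
    4 * (X * halfEdgeSeries) =
      3 * delannoySeries + 7 * (X * d⁄dX ℚ delannoySeries) - d⁄dX ℚ delannoySeries := by
  refine mul_right_cancel₀ one_sub_six_mul_X_add_X_sq_ne_zero ?_
  linear_combination 4 * X * halfEdgeSeries_mul - (7 * X - 1) * derivative_delannoySeries_mul

theorem coeff_X_mul_halfEdgeSeries_eq (n : ℕ) :
    4 * coeff n (X * halfEdgeSeries) =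
      (7 * n + 3) * coeff n delannoySeries - (n + 1) * coeff (n + 1) delannoySeries := by
  have h := congrArg (coeff n) four_mul_X_mul_halfEdgeSeries
  have h4 : (4 : ℚ⟦X⟧) = C 4 := (map_ofNat C 4).symm
  have h3 : (3 : ℚ⟦X⟧) = C 3 := (map_ofNat C 3).symm
  have h7 : (7 : ℚ⟦X⟧) = C 7 := (map_ofNat C 7).symm
  rw [h4, h3, h7, map_sub, map_add, coeff_C_mul, coeff_C_mul, coeff_C_mul, coeff_derivative] at h
  have hX : coeff n (X * d⁄dX ℚ delannoySeries) = n * coeff n delannoySeries := by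
    rcases n with _ | n
    · simp
    · rw [coeff_succ_X_mul, coeff_derivative]
      push_cast
      ring
  rw [hX] at h
  linear_combination h

end PowerSeries

/-! ### The exact formulas -/

theorem GrandSchroder.edgeSeries_eq :
    edgeSeries GrandSchroder = 2 * (X * halfEdgeSeries) := by
  have h2 : (2 : ℚ⟦X⟧) = C 2 := (map_ofNat C 2).symm
  ext n
  rw [edgeSeries, coeff_mk, GrandSchroder.cast_hasseEdgeCount_eq, h2, coeff_C_mul,
    coeff_X_mul_halfEdgeSeries]

theorem GrandSchroder.edgeSeries_eq_mul_inv :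
    edgeSeries GrandSchroder =
      2 * (X - X ^ 2) * (PowerSeries.ratPow (1 - 6 * X + X ^ 2) (3 / 2))⁻¹ := by
  rw [edgeSeries_eq, halfEdgeSeries_eq, delannoySeries₃_eq_inv]
  ring

theorem GrandSchroder.cast_card_eq_coeff (n : ℕ) :
    (Nat.card (GrandSchroder n) : ℚ) = coeff n delannoySeries := by
  rw [GrandSchroder.card_eq, coeff_delannoySeries]
  push_cast
  rfl

theorem GrandSchroder.cast_hasseEdgeCount_eq_card (n : ℕ) :
    2 * (hasseEdgeCount (GrandSchroder n) : ℚ) =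
      (7 * n + 3) * (Nat.card (GrandSchroder n) : ℚ) -
        (n + 1) * (Nat.card (GrandSchroder (n + 1)) : ℚ) := by
  rw [cast_card_eq_coeff, cast_card_eq_coeff, ← coeff_X_mul_halfEdgeSeries_eq,
    coeff_X_mul_halfEdgeSeries, cast_hasseEdgeCount_eq]
  ring

theorem choose_mul_choose_sub (n k : ℕ) :
    n.choose k * (n - k).choose k = n.choose (2 * k) * k.centralBinom := by
  by_cases h : 2 * k ≤ n
  · have := Nat.choose_mul (n := n) (k := 2 * k) (s := k) (by omega)
    rw [Nat.centralBinom_eq_two_mul_choose, this, show 2 * k - k = k by omega]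
  · rw [Nat.choose_eq_zero_of_lt (n := n - k) (by omega),
      Nat.choose_eq_zero_of_lt (n := n) (k := 2 * k) (by omega), mul_zero, zero_mul]

/-- The bracket is what the factor `1 - X` leaves of the `k`-th terms of two consecutive
coefficients of `delannoySeries₃`, once the common power of 3 is taken out. -/
theorem two_mul_add_one_mul_three_mul_choose_sub_choose {n k : ℕ} (h : 2 * k ≤ n) :
    (2 * k + 1 : ℚ) * (3 * ((n + 1).choose (2 * k + 2) : ℚ) - (n.choose (2 * k + 2) : ℚ)) =
      (n.choose (2 * k) : ℚ) * ((n - 2 * k) * (n + k + 2) / (k + 1)) := by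
  have h₁ := congrArg (Nat.cast (R := ℚ)) (Nat.choose_succ_right_eq n (2 * k))
  have h₂ := congrArg (Nat.cast (R := ℚ)) (Nat.choose_succ_right_eq n (2 * k + 1))
  have h₃ := congrArg (Nat.cast (R := ℚ)) (Nat.choose_succ_succ' n (2 * k + 1))
  rcases h.eq_or_lt with rfl | h
  · simp [Nat.choose_eq_zero_of_lt]
  rw [show 2 * k + 1 + 1 = 2 * k + 2 from rfl] at h₂ h₃
  push_cast [Nat.cast_sub h.le, Nat.cast_sub (Nat.succ_le_of_lt h)] at h₁ h₂ h₃
  rw [h₃]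
  field_simp
  linear_combination (2 * k + 1 : ℚ) * h₂ + (n + k + 2 : ℚ) * h₁

theorem GrandSchroder.cast_hasseEdgeCount_eq_sum (n : ℕ) :
    (hasseEdgeCount (GrandSchroder n) : ℚ) =
      ∑ k ∈ Finset.range (n / 2 + 1),
        (n.choose k : ℚ) * ((n - k).choose k : ℚ) *
          (((n : ℚ) - 2 * (k : ℚ)) * ((n : ℚ) + (k : ℚ) + 2) / ((k : ℚ) + 1)) *
          2 ^ (k + 1) * (3 : ℚ) ^ ((n : ℤ) - 2 * (k : ℤ) - 2) := by
  -- The coefficient of index `n - 2` enters below, so `n = 0` and `n = 1` are checked directly.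
  rcases n with _ | _ | m
  · simp [cast_hasseEdgeCount_eq]
  · simp [cast_hasseEdgeCount_eq, Finset.sum_range_succ]
    norm_num
  have h := congrArg (coeff (m + 2)) edgeSeries_eq
  have h2 : (2 : ℚ⟦X⟧) = C 2 := (map_ofNat C 2).symm
  rw [edgeSeries, coeff_mk, halfEdgeSeries_eq, h2, coeff_C_mul, coeff_succ_X_mul, sub_mul, one_mul,
    map_sub, coeff_succ_X_mul, coeff_delannoySeries₃ (N := (m + 2) / 2 + 1) (by omega),
    coeff_delannoySeries₃ (N := (m + 2) / 2 + 1) (by omega), ← Finset.sum_sub_distrib,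
    Finset.mul_sum] at h
  rw [h]
  refine Finset.sum_congr rfl fun k hk => ?_
  have hk' : 2 * k ≤ m + 2 := by
    have := Finset.mem_range.1 hk
    omega
  -- Truncated and integer exponents differ only for `2k > a`, where the binomial coefficient
  -- vanishes.
  have hpow (a : ℕ) (ha : a ≤ m + 1) : ((a + 2).choose (2 * k + 2) : ℚ) * 3 ^ (a - 2 * k) =
      ((a + 2).choose (2 * k + 2) : ℚ) * (3 : ℚ) ^ ((a : ℤ) - 2 * k) := by
    by_cases hka : 2 * k ≤ a
    · rw [← zpow_natCast (3 : ℚ) (a - 2 * k)]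
      push_cast [Nat.cast_sub hka]
      rfl
    · rw [Nat.choose_eq_zero_of_lt (by omega)]
      simp
  have h₁ := hpow (m + 1) le_rfl
  have h₂ := hpow m (Nat.le_succ m)
  have h₃ := two_mul_add_one_mul_three_mul_choose_sub_choose hk'
  have h₄ := congrArg (Nat.cast (R := ℚ)) (choose_mul_choose_sub (m + 2) k)
  rw [show ((m + 1 : ℕ) : ℤ) - 2 * k = ((m : ℤ) - 2 * k) + 1 by push_cast; ring,
    zpow_add_one₀ (by norm_num)] at h₁
  rw [show ((m + 1 + 1 : ℕ) : ℤ) - 2 * (k : ℤ) - 2 = (m : ℤ) - 2 * k by push_cast; ring]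
  push_cast at h₃ h₄ ⊢
  rw [h₄]
  linear_combination 2 * (2 * k + 1 : ℚ) * k.centralBinom * 2 ^ k * (h₁ - h₂) +
    2 * k.centralBinom * 2 ^ k * (3 : ℚ) ^ ((m : ℤ) - 2 * k) * h₃

/-! ### Asymptotics by Laplace's method -/

section Laplace

open MeasureTheory Real Topology

theorem integral_cos_pow_zero_pi (k : ℕ) :
    (∫ x in (0 : ℝ)..π, cos x ^ (2 * k)) = π * (k.centralBinom / 4 ^ k) ∧
      (∫ x in (0 : ℝ)..π, cos x ^ (2 * k + 1)) = 0 := by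
  induction k with
  | zero => simp
  | succ k ih =>
    constructor
    · rw [mul_add, mul_one, integral_cos_pow, ih.1]
      have h := congrArg (Nat.cast (R := ℝ)) (Nat.succ_mul_centralBinom_succ k)
      push_cast at h ⊢
      rw [sin_pi, sin_zero]
      field_simp
      linear_combination -2 * π * 4 ^ k * h
    · rw [show 2 * (k + 1) + 1 = 2 * k + 1 + 2 by ring, integral_cos_pow, ih.2]
      simp

theorem Finset.sum_range_two_mul {M : Type*} [AddCommMonoid M] (f : ℕ → M) (n : ℕ) :
    ∑ j ∈ Finset.range (2 * n), f j = ∑ k ∈ Finset.range n, (f (2 * k) + f (2 * k + 1)) := by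
  induction n with
  | zero => simp
  | succ n ih =>
    rw [mul_add, mul_one, Finset.sum_range_succ, Finset.sum_range_succ, ih,
      Finset.sum_range_succ, add_assoc]

/-- Odd powers of the cosine integrate to zero, even ones to central binomial coefficients. For `a =
3`, `b = 2√2` the sum is the coefficient of `delannoySeries'`. -/
theorem integral_add_mul_cos_pow (a b : ℝ) (n : ℕ) :
    ∫ x in (0 : ℝ)..π, (a + b * cos x) ^ n =
      π * ∑ k ∈ Finset.range (n + 1),
        (n.choose (2 * k) : ℝ) * k.centralBinom * (b ^ 2 / 4) ^ k * a ^ (n - 2 * k) := by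
  have h (x : ℝ) : (a + b * cos x) ^ n = ∑ j ∈ Finset.range (2 * (n + 1)),
      (b ^ j * a ^ (n - j) * n.choose j) * cos x ^ j := by
    rw [Finset.eventually_constant_sum (N := n + 1) (fun j hj => by
      rw [Nat.choose_eq_zero_of_lt (by omega)]; simp) (by omega), add_comm, add_pow]
    exact Finset.sum_congr rfl fun j _ => by rw [mul_pow]; ring
  simp_rw [h]
  rw [intervalIntegral.integral_finsetSum fun j _ => Continuous.intervalIntegrable (by fun_prop) _ _]
  simp_rw [intervalIntegral.integral_const_mul]
  rw [Finset.sum_range_two_mul, Finset.mul_sum]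
  refine Finset.sum_congr rfl fun k _ => ?_
  rw [(integral_cos_pow_zero_pi k).1, (integral_cos_pow_zero_pi k).2, div_pow]
  ring

/-- By `1 - cos x = 2 sin²(x/2)`, `n` times the deviation of the base from 1 is `-(β/2) t²
sinc²(t/(2√n))`. -/
theorem tendsto_one_sub_mul_one_sub_cos_pow (β : ℝ) {t : ℝ} (ht : t ≠ 0) :
    Tendsto (fun n : ℕ => (1 - β * (1 - cos (t / √n))) ^ n) atTop (𝓝 (exp (-(β / 2) * t ^ 2))) := by
  simp_rw [sub_eq_add_neg (1 : ℝ) (β * _)]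
  apply tendsto_one_add_pow_exp_of_tendsto
  have hx : Tendsto (fun n : ℕ => t / √n / 2) atTop (𝓝 0) := by
    have : Tendsto (fun n : ℕ => √(n : ℝ)) atTop atTop :=
      tendsto_sqrt_atTop.comp tendsto_natCast_atTop_atTop
    simpa using (this.const_div_atTop t).div_const 2
  have hsinc : Tendsto (fun n : ℕ => -(β / 2) * t ^ 2 * sinc (t / √n / 2) ^ 2) atTop
      (𝓝 (-(β / 2) * t ^ 2)) := by
    have := ((continuous_sinc.tendsto 0).comp hx).pow 2
    simpa only [Function.comp_def, sinc_zero, one_pow, mul_one] using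
      this.const_mul (-(β / 2) * t ^ 2)
  refine hsinc.congr' ?_
  filter_upwards [eventually_gt_atTop 0] with n hn
  have hn' : (0 : ℝ) < n := Nat.cast_pos.2 hn
  have hs : √(n : ℝ) ≠ 0 := (sqrt_pos.2 hn').ne'
  have hcos : 1 - cos (t / √n) = 2 * sin (t / √n / 2) ^ 2 := by
    have := cos_sq' (t / √n / 2)
    have h2 := cos_two_mul (t / √n / 2)
    rw [mul_div_cancel₀ _ two_ne_zero] at h2
    linarith
  rw [hcos, sinc_of_ne_zero (by positivity), div_pow, div_pow, div_pow, sq_sqrt hn'.le]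
  field_simp

/-- Combines `cos x ≤ 1 - 2x²/π²` with `1 + y ≤ exp y`; `β ≤ 1/2` keeps the base nonnegative. At `x
= t/√n` the bound is a Gaussian in `t` independent of `n`, as dominated convergence requires. -/
theorem one_sub_mul_one_sub_cos_pow_le {β : ℝ} (hβ : 0 ≤ β) (hβ' : β ≤ 1 / 2) {x : ℝ}
    (hx : |x| ≤ π) (n : ℕ) :
    0 ≤ (1 - β * (1 - cos x)) ^ n ∧
      (1 - β * (1 - cos x)) ^ n ≤ exp (-(2 * β / π ^ 2) * (n * x ^ 2)) := by
  have h₀ : 0 ≤ 1 - β * (1 - cos x) := by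
    nlinarith [neg_one_le_cos x, cos_le_one x]
  refine ⟨pow_nonneg h₀ n, ?_⟩
  have h₁ := cos_le_one_sub_mul_cos_sq hx
  have h₂ := add_one_le_exp (-(β * (2 / π ^ 2 * x ^ 2)))
  have h₃ : 1 - β * (1 - cos x) ≤ exp (-(β * (2 / π ^ 2 * x ^ 2))) := by
    nlinarith
  refine (pow_le_pow_left₀ h₀ h₃ n).trans_eq ?_
  rw [← exp_nat_mul]
  congr 1
  ring

/-- The substitution `t = √n x` absorbs the factor `√n` and stretches the interval to `(0, π√n]`;
the limit is a half-line Gaussian integral. -/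
theorem tendsto_sqrt_mul_integral_pow {β : ℝ} (hβ : 0 < β) (hβ' : β ≤ 1 / 2) :
    Tendsto (fun n : ℕ => √(n : ℝ) * ∫ x in (0 : ℝ)..π, (1 - β * (1 - cos x)) ^ n) atTop
      (𝓝 (√(π / (β / 2)) / 2)) := by
  rw [← integral_gaussian_Ioi]
  have hb : 0 < 2 * β / π ^ 2 := by positivity
  have key : Tendsto (fun n : ℕ => ∫ t in Set.Ioi (0 : ℝ), (Set.Ioc 0 (π * √n)).indicator
      (fun t => (1 - β * (1 - cos (t / √n))) ^ n) t) atTop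
      (𝓝 (∫ t in Set.Ioi (0 : ℝ), exp (-(β / 2) * t ^ 2))) := by
    refine tendsto_integral_of_dominated_convergence
      (fun t => exp (-(2 * β / π ^ 2) * t ^ 2)) (fun n => ?_)
      (integrable_exp_neg_mul_sq hb).integrableOn (fun n => ?_) ?_
    · exact ((by fun_prop : Continuous fun t : ℝ =>
        (1 - β * (1 - cos (t / √n))) ^ n).aestronglyMeasurable).indicator measurableSet_Ioc
    · refine Eventually.of_forall fun t => ?_
      by_cases ht : t ∈ Set.Ioc 0 (π * √n)
      · rw [Set.indicator_of_mem ht]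
        have hs : 0 < √(n : ℝ) := by
          by_contra hcon
          have := mul_nonpos_of_nonneg_of_nonpos pi_pos.le (not_lt.1 hcon)
          linarith [ht.1, ht.2]
        have hx : |t / √n| ≤ π := by
          rw [abs_of_pos (div_pos ht.1 hs), div_le_iff₀ hs]
          exact ht.2
        obtain ⟨h₀, h₁⟩ := one_sub_mul_one_sub_cos_pow_le hβ.le hβ' hx n
        rw [norm_of_nonneg h₀]
        refine h₁.trans_eq ?_
        rw [div_pow, sq_sqrt (Nat.cast_nonneg n), mul_div_cancel₀]
        exact (sqrt_pos.1 hs).ne'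
      · rw [Set.indicator_of_notMem ht, norm_zero]
        positivity
    · refine (ae_restrict_mem measurableSet_Ioi).mono fun t ht => ?_
      refine (tendsto_one_sub_mul_one_sub_cos_pow β (ne_of_gt ht)).congr' ?_
      have : Tendsto (fun n : ℕ => π * √(n : ℝ)) atTop atTop :=
        (tendsto_sqrt_atTop.comp tendsto_natCast_atTop_atTop).const_mul_atTop pi_pos
      filter_upwards [this.eventually_ge_atTop t] with n hn
      rw [Set.indicator_of_mem (show t ∈ Set.Ioc 0 (π * √(n : ℝ)) from ⟨ht, hn⟩)]
  refine key.congr' ?_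
  filter_upwards [eventually_gt_atTop 0] with n hn
  have hs : 0 < √(n : ℝ) := sqrt_pos.2 (Nat.cast_pos.2 hn)
  rw [setIntegral_indicator measurableSet_Ioc,
    Set.inter_eq_self_of_subset_right Set.Ioc_subset_Ioi_self,
    ← intervalIntegral.integral_of_le (by positivity),
    intervalIntegral.integral_comp_div (fun x => (1 - β * (1 - cos x)) ^ n) hs.ne', zero_div,
    mul_div_cancel_right₀ _ hs.ne', smul_eq_mul]

end Laplace

/-! ### Asymptotics of the cardinals, the Hasse index and the edge counts. -/

namespace GrandSchroder

open Topology

theorem cast_card_eq_integral (n : ℕ) :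
    (Nat.card (GrandSchroder n) : ℝ) * Real.pi =
      ∫ x in (0 : ℝ)..Real.pi, (3 + 2 * √2 * Real.cos x) ^ n := by
  have h : (Nat.card (GrandSchroder n) : ℚ) = ∑ k ∈ Finset.range (n + 1),
      (n.choose (2 * k) : ℚ) * (k.centralBinom : ℚ) * 2 ^ k * 3 ^ (n - 2 * k) := by
    rw [cast_card_eq_coeff, ← delannoySeries'_eq, coeff_delannoySeries']
  have h' := congrArg (Rat.cast (K := ℝ)) h
  push_cast at h'
  rw [h', integral_add_mul_cos_pow, mul_comm,
    show (2 * √2) ^ 2 / 4 = (2 : ℝ) by rw [mul_pow, Real.sq_sqrt zero_le_two]; norm_num]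

theorem tendsto_sqrt_mul_card_div :
    Tendsto (fun n : ℕ => √(n : ℝ) * (Nat.card (GrandSchroder n) : ℝ) / (3 + 2 * √2) ^ n) atTop
      (𝓝 (√((3 + 2 * √2) / (4 * √2 * Real.pi)))) := by
  have hs : 0 < √(2 : ℝ) := by positivity
  have hsq : √(2 : ℝ) ^ 2 = 2 := Real.sq_sqrt zero_le_two
  have hM : 0 < 3 + 2 * √(2 : ℝ) := by positivity
  -- With `M = 3 + 2√2`, the maximum of the integrand's base, `3 + 2√2 cos x = M (1 - β (1 - cos
  -- x))` for this `β`.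
  have h := (tendsto_sqrt_mul_integral_pow (β := 2 * √2 / (3 + 2 * √2)) (by positivity) (by
    rw [div_le_iff₀ hM]; nlinarith)).div_const Real.pi
  have hlim : √(Real.pi / (2 * √2 / (3 + 2 * √2) / 2)) / 2 / Real.pi =
      √((3 + 2 * √2) / (4 * √2 * Real.pi)) := by
    rw [eq_comm, Real.sqrt_eq_iff_mul_self_eq (by positivity) (by positivity), ← sq, div_pow,
      div_pow, Real.sq_sqrt (by positivity)]
    field_simp
    norm_num
  rw [hlim] at h
  refine h.congr fun n => ?_
  have hint : (3 + 2 * √2) ^ n * ∫ x in (0 : ℝ)..Real.pi,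
      (1 - 2 * √2 / (3 + 2 * √2) * (1 - Real.cos x)) ^ n =
      ∫ x in (0 : ℝ)..Real.pi, (3 + 2 * √2 * Real.cos x) ^ n := by
    rw [← intervalIntegral.integral_const_mul]
    congr 1 with x
    rw [← mul_pow]
    congr 1
    field_simp
    ring
  rw [← cast_card_eq_integral] at hint
  rw [div_eq_div_iff (by positivity) (by positivity), mul_assoc (√(n : ℝ)) _ Real.pi, ← hint]
  ring

theorem card_pos (n : ℕ) : 0 < Nat.card (GrandSchroder n) := by
  rw [card_eq]
  exact Finset.sum_pos' (fun _ _ => Nat.zero_le _) ⟨0, by simp, by simp⟩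

theorem tendsto_card_succ_div_card :
    Tendsto (fun n : ℕ => (Nat.card (GrandSchroder (n + 1)) : ℝ) / Nat.card (GrandSchroder n)) atTop
      (𝓝 (3 + 2 * √2)) := by
  have hM : 0 < 3 + 2 * √(2 : ℝ) := by positivity
  have hK : √((3 + 2 * √2) / (4 * √2 * Real.pi)) ≠ 0 := by positivity
  have h := (tendsto_sqrt_mul_card_div.comp (tendsto_add_atTop_nat 1)).div
    tendsto_sqrt_mul_card_div hK
  rw [div_self hK] at h
  have hr : Tendsto (fun n : ℕ => √((n : ℝ) / (n + 1 : ℕ))) atTop (𝓝 1) := by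
    have := (Real.continuous_sqrt.tendsto 1).comp (tendsto_natCast_div_add_atTop (1 : ℝ))
    simpa [Function.comp_def] using this
  have h' := (h.mul hr).const_mul (3 + 2 * √2)
  rw [mul_one, mul_one] at h'
  refine h'.congr' ?_
  filter_upwards [eventually_gt_atTop 0] with n hn
  have hn' : (0 : ℝ) < n := Nat.cast_pos.2 hn
  have hc : (0 : ℝ) < Nat.card (GrandSchroder n) := Nat.cast_pos.2 (card_pos n)
  have h1 : (0 : ℝ) < (n + 1 : ℕ) := Nat.cast_pos.2 n.succ_pos
  have h1' := Real.sqrt_pos.2 h1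
  have h2' := Real.sqrt_pos.2 hn'
  simp only [Pi.div_apply, Function.comp_apply]
  rw [Real.sqrt_div hn'.le, pow_succ]
  field_simp

theorem two_sub_sqrt_two_pos : 0 < 2 - √(2 : ℝ) := by
  nlinarith [Real.sq_sqrt (zero_le_two (α := ℝ)), Real.sqrt_nonneg 2]

/-- The linear relation between edges and cardinals is divided by `2n |GS_n|`, and the ratio of
consecutive cardinals tends to `3 + 2√2`. -/
theorem hasseIndex_isEquivalent :
    (fun n : ℕ => hasseIndex (GrandSchroder n)) ~[atTop] (fun n : ℕ => (2 - √2) * (n : ℝ)) := by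
  have hpos := two_sub_sqrt_two_pos
  refine isEquivalent_of_tendsto_one ?_
  have hinv : Tendsto (fun n : ℕ => (n : ℝ)⁻¹) atTop (𝓝 0) :=
    tendsto_inv_atTop_zero.comp tendsto_natCast_atTop_atTop
  have h : Tendsto (fun n : ℕ => ((7 + 3 * (n : ℝ)⁻¹) - (1 + (n : ℝ)⁻¹) *
      ((Nat.card (GrandSchroder (n + 1)) : ℝ) / Nat.card (GrandSchroder n))) /
        (2 * (2 - √2))) atTop
      (𝓝 (((7 + 3 * 0) - (1 + 0) * (3 + 2 * √2)) / (2 * (2 - √2)))) :=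
    (((hinv.const_mul 3).const_add 7).sub
      ((hinv.const_add 1).mul tendsto_card_succ_div_card)).div_const _
  rw [show ((7 + 3 * 0) - (1 + 0) * (3 + 2 * √2)) / (2 * (2 - √2)) = 1 by
    rw [div_eq_one_iff_eq (by positivity)]; ring] at h
  refine h.congr' ?_
  filter_upwards [eventually_gt_atTop 0] with n hn
  have hn' : (0 : ℝ) < n := Nat.cast_pos.2 hn
  have hc : (0 : ℝ) < Nat.card (GrandSchroder n) := Nat.cast_pos.2 (card_pos n)
  have hl := congrArg (Rat.cast (K := ℝ)) (cast_hasseEdgeCount_eq_card n)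
  push_cast at hl
  rw [Pi.div_apply, hasseIndex]
  field_simp
  linear_combination -hl

theorem hasseEdgeCount_isEquivalent :
    (fun n : ℕ => (hasseEdgeCount (GrandSchroder n) : ℝ)) ~[atTop]
      (fun n : ℕ => √((n : ℝ) / (2 * √2 * Real.pi)) * (1 + √2) ^ (2 * n)) := by
  have hpos := two_sub_sqrt_two_pos
  have hsq : √(2 : ℝ) ^ 2 = 2 := Real.sq_sqrt zero_le_two
  have hs : 0 < √(2 : ℝ) := by positivity
  have hM : 0 < 3 + 2 * √(2 : ℝ) := by positivity
  have hK : 0 < √((3 + 2 * √2) / (4 * √2 * Real.pi)) := by positivity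
  have hcard : (fun n : ℕ => (Nat.card (GrandSchroder n) : ℝ)) ~[atTop]
      (fun n : ℕ => √((3 + 2 * √2) / (4 * √2 * Real.pi)) * (3 + 2 * √2) ^ n / √n) := by
    refine isEquivalent_of_tendsto_one ?_
    have h := tendsto_sqrt_mul_card_div.div_const √((3 + 2 * √2) / (4 * √2 * Real.pi))
    rw [div_self hK.ne'] at h
    refine h.congr fun n => ?_
    rw [Pi.div_apply, div_div_eq_mul_div, div_div]
    ring
  have h := hasseIndex_isEquivalent.mul hcard
  refine (h.congr_left ?_).congr_right ?_
  · refine Eventually.of_forall fun n => ?_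
    have hc : (0 : ℝ) < Nat.card (GrandSchroder n) := Nat.cast_pos.2 (card_pos n)
    rw [Pi.mul_apply, hasseIndex, div_mul_cancel₀ _ hc.ne']
  · filter_upwards [eventually_gt_atTop 0] with n hn
    have hn' : (0 : ℝ) < n := Nat.cast_pos.2 hn
    have hn2 := Real.sqrt_pos.2 hn'
    have hroot : √((n : ℝ) / (2 * √2 * Real.pi)) =
        (2 - √2) * √((3 + 2 * √2) / (4 * √2 * Real.pi)) * √n := by
      rw [Real.sqrt_eq_iff_mul_self_eq (by positivity) (by positivity), ← sq, mul_pow, mul_pow,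
        Real.sq_sqrt hn'.le, Real.sq_sqrt (by positivity)]
      have : (2 - √2) ^ 2 * (3 + 2 * √2) = (2 : ℝ) := by
        linear_combination (2 * √2 - 5) * hsq
      rw [mul_div_assoc', this]
      field_simp
      norm_num
    rw [Pi.mul_apply, hroot, pow_mul, show (1 + √2) ^ 2 = 3 + 2 * √2 by linear_combination hsq]
    field_simp
    rw [Real.sq_sqrt hn'.le]

theorem isAsymptoticallyQuasiBoolean : IsAsymptoticallyQuasiBoolean GrandSchroder := by
  have hsq : √(2 : ℝ) ^ 2 = 2 := Real.sq_sqrt zero_le_two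
  have hs : 0 ≤ √(2 : ℝ) := Real.sqrt_nonneg 2
  -- The witness is `(2 - √2) - 1/2`, about `0.086`.
  refine ⟨3 / 2 - √2, by nlinarith, by nlinarith, Or.inl ?_⟩
  rw [show (1 / 2 + (3 / 2 - √2) : ℝ) = 2 - √2 by ring]
  exact hasseIndex_isEquivalent

end GrandSchroder

theorem mainTheorem6 :
    edgeSeries GrandSchroder =
        2 * (X - X ^ 2) * (PowerSeries.ratPow (1 - 6 * X + X ^ 2) (3 / 2))⁻¹ ∧
    (∀ n : ℕ, (hasseEdgeCount (GrandSchroder n) : ℚ) =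
        2 * ∑ k ∈ Finset.range (n + 1),
          ((n + k).choose (2 * k) : ℚ) * ((2 * k).choose k : ℚ) * ((n : ℚ) - (k : ℚ))) ∧
    (∀ n : ℕ, (hasseEdgeCount (GrandSchroder n) : ℚ) =
        ∑ k ∈ Finset.range (n / 2 + 1),
          (n.choose k : ℚ) * ((n - k).choose k : ℚ) *
            (((n : ℚ) - 2 * (k : ℚ)) * ((n : ℚ) + (k : ℚ) + 2) / ((k : ℚ) + 1)) *
            2 ^ (k + 1) * (3 : ℚ) ^ ((n : ℤ) - 2 * (k : ℤ) - 2)) ∧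
    (fun n : ℕ => (hasseEdgeCount (GrandSchroder n) : ℝ)) ~[atTop]
      (fun n : ℕ => √((n : ℝ) / (2 * √2 * Real.pi)) * (1 + √2) ^ (2 * n)) ∧
    (fun n : ℕ => hasseIndex (GrandSchroder n)) ~[atTop] (fun n : ℕ => (2 - √2) * (n : ℝ)) ∧
    IsAsymptoticallyQuasiBoolean GrandSchroder :=
  ⟨GrandSchroder.edgeSeries_eq_mul_inv, GrandSchroder.cast_hasseEdgeCount_eq,
    GrandSchroder.cast_hasseEdgeCount_eq_sum, GrandSchroder.hasseEdgeCount_isEquivalent,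
    GrandSchroder.hasseIndex_isEquivalent, GrandSchroder.isAsymptoticallyQuasiBoolean⟩
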